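/- Write $\log$ for the logarithm in base $2$ and $U_m$ for a uniform $m$-bit string. For a normalized state $\rho_{AB}$ of a finite-dimensional bipartite quantum system, $H_{\min}(A|B)_\rho=\sup\{\lambda\in\mathbb R : 2^{-\lambda}\,1_A\otimes\sigma_B\ge\rho_{AB}\text{ for some normalized state }\sigma_B\}$, and $\|A\|_{\mathrm{tr}}=\operatorname{tr}\sqrt{A^\dagger A}$. A function $\mathrm{Ext}:\{0,1\}^n\times\{0,1\}^d\to\{0,1\}^m$ is a *quantum-proof $(k,\varepsilon)$-strong extractor with uniform seed* if for every finite-dimensional quantum system $E$ and every normalized state $\rho_{XE}$ classical on $X\in\{0,1\}^n$ with $H_{\min}(X|E)_\rho\ge k$, and for a uniform seed $Y\in\{0,1\}^d$ independent of $XE$, $$\tfrac12\left\|\rho_{\mathrm{Ext}(X,Y)YE}-\rho_{U_m}\otimes\rho_Y\otimes\rho_E\right\|_{\mathrm{tr}}\le\varepsilon .$$ *Trevisan-based extractor.* Given $n$, $m$ and an error $\varepsilon$, put $\delta=\varepsilon^2/(9m^2)$. Let $t$ be a natural number and $\mathcal C:\{0,1\}^n\to\{0,1\}^{2^t}$ a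 $(\delta/2,4/\delta^2)$-list-decodable code, i.e. every Hamming ball of relative radius $\tfrac12-\tfrac\delta2$ contains the codewords of at most $4/\delta^2$ messages, and let $S_1,\dots,S_m\subset[d]$, with $d=t\lceil t/\ln 2\rceil\lceil\log 4m\rceil$, be a weak $(t,1)$-design, i.e. $|S_i|=t$ and $\sum_{j<i}2^{|S_j\cap S_i|}\le m$ for all $i$. The extractor is $(x,y)\mapsto \mathcal C(x)_{y_{S_1}}\cdots \mathcal C(x)_{y_{S_m}}$, where $y_S$ is the restriction of $y$ to the positions in $S$. (For $m=0$ it is the function with empty output and $d=0$.) *Hashing extractor.* Given $n$, $m$ and an error $\varepsilon$, this is a function $\mathrm{Ext}:\{0,1\}^n\times\{0,1\}^d\to\{0,1\}^m$ for which $\{\mathrm{Ext}(\cdot,y)\}_y$ is a $\frac{1+\varepsilon^2}{2^m}$-almost two-universal family of hash functions, i.e. $\Pr_Y[\mathrm{Ext}(x,Y)=\mathrm{Ext}(x',Y)]\le(1+\varepsilon^2)2^{-m}$ for all $x\ne x'$. **Statement.** There are constants $c,C$, and for every $a\ge0$ a constant $C_a$, such that for all integers $2\le m\le n$ and all $0<\varepsilon<1$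 there are $m_1+m_2=m$, positive $\varepsilon_1+\varepsilon_2=\varepsilon$, a Trevisan-based extractor $\mathrm{Ext}_1:\{0,1\}^n\times\{0,1\}^{d_1}\to\{0,1\}^{m_1}$ for error $\varepsilon_1$ and a hashing extractor $\mathrm{Ext}_2:\{0,1\}^n\times\{0,1\}^{d_2}\to\{0,1\}^{m_2}$ for error $\varepsilon_2$ such that their composition $$\mathrm{Ext}:\{0,1\}^n\times\{0,1\}^{d}\to\{0,1\}^{m},\qquad (x,(y_1,y_2))\mapsto(\mathrm{Ext}_1(x,y_1),\mathrm{Ext}_2(x,y_2)),\qquad d=d_1+d_2,$$ is a quantum-proof $(m+4\log(1/\varepsilon)+c,\ \varepsilon)$-strong extractor with uniform seed, and its seed length satisfies $d\le C\,\log^2(n/\varepsilon)\,\log m$. In particular, if $\varepsilon\ge n^{-a}$, then $d\le C_a\log^3 n$. -/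

import Mathlib

namespace QExtractor

open scoped Kronecker ComplexOrder

/-- Bit strings of length `n`. -/
abbrev BitString (n : ℕ) : Type := Fin n → Bool

noncomputable section Quantum

/-- A normalized quantum state on the finite-dimensional Hilbert space with orthonormal basis
indexed by `ι`: a positive semidefinite matrix of trace one. -/
structure IsState {ι : Type} [Fintype ι] (ρ : Matrix ι ι ℂ) : Prop where
  posSemidef : ρ.PosSemidef
  trace_eq_one : ρ.trace = 1

/-- The operator `ρ^x` (weighted by the probability of `x`) in a state
`∑ x, |x⟩⟨x| ⊗ ρ^x` of a bipartite system `XE`. -/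
def block {α ι : Type} (ρ : Matrix (α × ι) (α × ι) ℂ) (x : α) : Matrix ι ι ℂ :=
  ρ.submatrix (fun i => (x, i)) (fun i => (x, i))

/-- The state `ρ` of the bipartite system `XE` is classical on `X`, in the fixed basis of `X`:
`ρ = ∑ x, |x⟩⟨x| ⊗ ρ^x`. -/
def IsClassicalOnLeft {α ι : Type} [Fintype α] [DecidableEq α] (ρ : Matrix (α × ι) (α × ι) ℂ) :
    Prop :=
  ρ = ∑ x : α, Matrix.single x x (1 : ℂ) ⊗ₖ block ρ x

/-- The reduced operator `ρ_E` of `ρ_{XE}` (the partial trace over `X`). -/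
def reducedRight {α ι : Type} [Fintype α] (ρ : Matrix (α × ι) (α × ι) ℂ) : Matrix ι ι ℂ :=
  ∑ x : α, block ρ x

/-- The conditional min-entropy `H_min(A|B)_ρ` in bits: the supremum of all `λ` for which there is
a normalized state `σ` of `B` with `2^{-λ} 1_A ⊗ σ ≥ ρ`. For a normalized state `ρ` the set is
nonempty and bounded above. -/
def minEntropy {α ι : Type} [Fintype α] [DecidableEq α] [Fintype ι]
    (ρ : Matrix (α × ι) (α × ι) ℂ) : ℝ :=
  sSup {l : ℝ | ∃ σ : Matrix ι ι ℂ, IsState σ ∧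
    ((((2 : ℝ) ^ (-l) : ℝ) : ℂ) • ((1 : Matrix α α ℂ) ⊗ₖ σ) - ρ).PosSemidef}

open scoped MatrixOrder in
/-- The trace norm `tr √(A† A)`. -/
def traceNorm {κ : Type} [Fintype κ] [DecidableEq κ] (A : Matrix κ κ ℂ) : ℝ :=
  (CFC.sqrt (A.conjTranspose * A)).trace.re

/-- The fully mixed state on a system with basis `κ`. -/
def maxMixed (κ : Type) [Fintype κ] [DecidableEq κ] : Matrix κ κ ℂ :=
  ((Fintype.card κ : ℂ)⁻¹) • (1 : Matrix κ κ ℂ)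

/-- The state `ρ_{Ext(X,Y) Y E}`, where `XE` is in the state `ρ`, classical on `X`, and the seed
`Y` is uniform and independent of `XE`. -/
def outputState {n d m : ℕ} {ι : Type} (E : BitString n → BitString d → BitString m)
    (ρ : Matrix (BitString n × ι) (BitString n × ι) ℂ) :
    Matrix (BitString m × BitString d × ι) (BitString m × BitString d × ι) ℂ :=
  ∑ x : BitString n, ∑ y : BitString d,
    (((2 : ℂ) ^ d)⁻¹) • (Matrix.single (E x y) (E x y) (1 : ℂ) ⊗ₖ
      (Matrix.single y y (1 : ℂ) ⊗ₖ block ρ x))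

/-- `E : {0,1}^n × {0,1}^d → {0,1}^m` is a quantum-proof `(k, ε)`-strong extractor with uniform
seed. The side information may be any finite-dimensional quantum system. -/
def IsQuantumProofStrongExtractor {n d m : ℕ} (k ε : ℝ)
    (E : BitString n → BitString d → BitString m) : Prop :=
  ∀ (ι : Type) [Fintype ι] [DecidableEq ι] (ρ : Matrix (BitString n × ι) (BitString n × ι) ℂ),
    IsState ρ → IsClassicalOnLeft ρ → k ≤ minEntropy ρ →
      (1 / 2 : ℝ) * traceNorm (outputState E ρ -
        maxMixed (BitString m) ⊗ₖ (maxMixed (BitString d) ⊗ₖ reducedRight ρ)) ≤ ε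

end Quantum

section Constructions

/-- A code whose codewords have their positions indexed by `κ` is `(δ, L)`-list-decodable: every
Hamming ball of relative radius `1/2 - δ` contains the codewords of at most `L` messages. -/
def IsListDecodable {n : ℕ} {κ : Type} [Fintype κ] (code : BitString n → κ → Bool) (δ L : ℝ) :
    Prop :=
  ∀ w : κ → Bool,
    (((Finset.univ.filter fun x : BitString n =>
      (hammingDist (code x) w : ℝ) ≤ (1 / 2 - δ) * (Fintype.card κ : ℝ)).card : ℕ) : ℝ) ≤ L

/-- The sets `S i` form a weak `(t, r)`-design in `{1, …, d}`. -/
structure IsWeakDesign {d m : ℕ} (t : ℕ) (r : ℝ) (S : Fin m → Finset (Fin d)) : Prop where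
  card_eq : ∀ i, (S i).card = t
  overlap : ∀ i, ∑ j ∈ Finset.univ.filter (fun j => j < i), (2 : ℝ) ^ (S j ∩ S i).card ≤ r * m

/-- Trevisan's construction: the `i`-th output bit is the one-bit function `C` applied to `x` and
to the restriction of the seed `y` to the positions in `S i` (in increasing order). -/
def trevisan {n t d m : ℕ} (C : BitString n → BitString t → Bool) (S : Fin m → Finset (Fin d))
    (hS : ∀ i, (S i).card = t) (x : BitString n) (y : BitString d) : BitString m :=
  fun i => C x (fun j => y ((S i).orderEmbOfFin (hS i) j))

/-- `E` is Trevisan's extractor for error `ε` built from a list-decodable code and a weak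
`(t, 1)`-design: with `δ = ε² / (9 m²)`, the one-bit extractor is `(x, y) ↦ code(x)_y` for a
`(δ/2, 4/δ²)`-list-decodable code of length `2 ^ t`, and the seed length is
`d = t ⌈t / ln 2⌉ ⌈log 4m⌉`. The maximum in `δ` matters only if `m = 0`, when `E` has no output. -/
def IsTrevisanExtractor {n d m : ℕ} (ε : ℝ) (E : BitString n → BitString d → BitString m) : Prop :=
  ∃ (t : ℕ) (δ : ℝ) (code : BitString n → BitString t → Bool) (S : Fin m → Finset (Fin d))
    (hS : IsWeakDesign t 1 S),
    δ = ε ^ 2 / (9 * (max m 1 : ℕ) ^ 2) ∧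
    IsListDecodable code (δ / 2) (4 / δ ^ 2) ∧
    d = t * ⌈(t : ℝ) / Real.log 2⌉₊ * ⌈Real.logb 2 (4 * m)⌉₊ ∧
    E = trevisan code S hS.card_eq

/-- The functions `x ↦ E x y`, for a uniformly random seed `y`, form a `δ`-almost two-universal
family of hash functions: any two distinct inputs collide with probability at most `δ`. -/
def IsAlmostTwoUniversal {n d m : ℕ} (δ : ℝ) (E : BitString n → BitString d → BitString m) : Prop :=
  ∀ x x' : BitString n, x ≠ x' →
    (((Finset.univ.filter fun y : BitString d => E x y = E x' y).card : ℕ) : ℝ) / 2 ^ d ≤ δ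

/-- The composition of two functions applied to the same input with separate seeds: the seed
`(y₁, y₂)` and the output `(E₁(x, y₁), E₂(x, y₂))` are written as concatenated bit strings. -/
def compose {n d₁ d₂ m₁ m₂ : ℕ} (E₁ : BitString n → BitString d₁ → BitString m₁)
    (E₂ : BitString n → BitString d₂ → BitString m₂) (x : BitString n) (y : BitString (d₁ + d₂)) :
    BitString (m₁ + m₂) :=
  Fin.append (E₁ x fun i => y (Fin.castAdd d₂ i)) (E₂ x fun i => y (Fin.natAdd d₁ i))

end Constructions

end QExtractor

namespace QExtractor

open scoped Kronecker ComplexOrder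

/-! ### Trace norm of Hermitian matrices -/

section TraceNorm

open scoped MatrixOrder

open Matrix

variable {κ : Type} [Fintype κ]

/-! Both stages rest on one estimate, the leftover hash lemma against quantum side information. The
code inside Trevisan's construction is chosen so that any two codewords agree in at most a fraction
`(1 + γ) / 2` of the positions. It is therefore list-decodable by the Johnson bound and, at the same
time, an almost two-universal family of one-bit hashes. Each output bit can thus be treated by
hashing, with no reconstruction argument for list decoding.

The outputs are compared with uniform one at a time (`hashDistance_bits_le`). With the seed outside
`S i` fixed, the bit `j < i` depends on the seed only through `S j ∩ S i`, so all earlier bits are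
determined by truth tables of total length at most `m₁`, by the weak design property. These tables
form classical side information with at most `2 ^ m₁` values, and `sum_hashDistance_le` says that it
costs at most `m₁` bits of entropy. For the hashing stage the whole first output is again side
information with `2 ^ m₁` values.

Adding up `m₁` bit errors forces each to be of order `ε / m₁`, which costs about `2 log m₁` further
bits of entropy. Choosing `m₂` about `2 log m` pays for this: the first stage need only leave `m₂`
bits unextracted, and the hashing stage extracts them. No logarithmic term in `m` remains in the
entropy requirement. The objects come from `exists_hash_family` (a polynomial hash followed by a
linear one) and `exists_weakDesign` (a greedy choice in blocks). -/

theorem trace_mul_re_nonneg {A B : Matrix κ κ ℂ} (hA : A.PosSemidef) (hB : B.PosSemidef) :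
    0 ≤ (A * B).trace.re := by
  classical
  obtain ⟨X, rfl⟩ := CStarAlgebra.nonneg_iff_eq_star_mul_self.mp hA.nonneg
  rw [Matrix.mul_assoc, Matrix.trace_mul_comm]
  exact (Complex.nonneg_iff.mp ((hB.mul_mul_conjTranspose_same X).trace_nonneg)).1

theorem trace_mul_re_mono {A B C : Matrix κ κ ℂ} (hA : A.PosSemidef) (h : B ≤ C) :
    (A * B).trace.re ≤ (A * C).trace.re := by
  have := trace_mul_re_nonneg hA (Matrix.le_iff.mp h)
  rw [Matrix.mul_sub, Matrix.trace_sub, Complex.sub_re] at this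
  linarith

variable [DecidableEq κ]

/-- The sign `W` of a Hermitian matrix. -/
theorem exists_sign {A : Matrix κ κ ℂ} (hA : A.IsHermitian) :
    ∃ W : Matrix κ κ ℂ, W.IsHermitian ∧ W * W = 1 ∧ (W * A).PosSemidef ∧ A ≤ W * A ∧
      -A ≤ W * A ∧ traceNorm A = (W * A).trace.re := by
  set U : Matrix κ κ ℂ := (hA.eigenvectorUnitary : Matrix κ κ ℂ) with hU
  have hUU : star U * U = 1 := Unitary.coe_star_mul_self _
  have hUU' : U * star U = 1 := Unitary.coe_mul_star_self _
  set e := hA.eigenvalues with he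
  let D : (κ → ℝ) → Matrix κ κ ℂ := fun f => U * diagonal (fun i => (f i : ℂ)) * star U
  have hDmul : ∀ f g, D f * D g = D (fun i => f i * g i) := by
    intro f g
    calc D f * D g = U * diagonal (fun i => (f i : ℂ)) * (star U * U) *
          diagonal (fun i => (g i : ℂ)) * star U := by simp only [D, Matrix.mul_assoc]
      _ = D (fun i => f i * g i) := by
          rw [hUU, Matrix.mul_one, Matrix.mul_assoc U, diagonal_mul_diagonal]
          simp [D]
  have hDpos : ∀ f : κ → ℝ, (∀ i, 0 ≤ f i) → (D f).PosSemidef := by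
    intro f hf
    have : (diagonal (fun i => (f i : ℂ))).PosSemidef :=
      PosSemidef.diagonal (fun i => by simpa using hf i)
    exact this.mul_mul_conjTranspose_same U
  have hDsub : ∀ f g, D f - D g = D (fun i => f i - g i) := by
    intro f g
    simp only [D]
    rw [← Matrix.sub_mul, ← Matrix.mul_sub, diagonal_sub]
    simp
  have hDone : D (fun _ => 1) = 1 := by
    simp [D, hUU']
  have hDA : A = D e := by
    have := hA.spectral_theorem
    rw [Unitary.conjStarAlgAut_apply] at this
    exact this
  have hDherm : ∀ f, (D f).IsHermitian := by
    intro f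
    have : (diagonal (fun i => (f i : ℂ))).IsHermitian := by
      simp [Matrix.isHermitian_diagonal_iff, isSelfAdjoint_iff]
    exact isHermitian_mul_mul_conjTranspose U this
  -- Zero eigenvalues get sign `+1`, so that `W * W = 1` holds also for singular `A`.
  let w : κ → ℝ := fun i => if 0 ≤ e i then 1 else -1
  have hw : ∀ i, w i * e i = |e i| := by
    intro i
    by_cases h : 0 ≤ e i
    · simp [w, h, abs_of_nonneg h]
    · simp [w, h, abs_of_neg (not_le.mp h)]
  have hWA : D w * A = D (fun i => |e i|) := by
    conv_lhs => rw [hDA]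
    rw [hDmul]; simp only [hw]
  refine ⟨D w, hDherm w, ?_, ?_, ?_, ?_, ?_⟩
  · rw [hDmul, ← hDone]
    congr 1; ext i; by_cases h : 0 ≤ e i <;> simp [w, h]
  · rw [hWA]; exact hDpos _ fun i => abs_nonneg _
  · rw [hWA, Matrix.le_iff, show (D fun i => |e i|) - A = (D fun i => |e i|) - D e from
      congrArg _ hDA, hDsub]
    exact hDpos _ fun i => by linarith [le_abs_self (e i)]
  · have : -A = D (fun i => - e i) := by
      have h0 : D (fun i => -e i) = D (fun _ => 0) - D e := by rw [hDsub]; simp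
      rw [h0, ← hDA]; simp [D]
    rw [hWA, Matrix.le_iff, this]
    rw [hDsub]; exact hDpos _ fun i => by linarith [neg_abs_le (e i)]
  · have h2 : A.conjTranspose * A = D (fun i => |e i|) * D (fun i => |e i|) := by
      rw [hA.eq]
      conv_lhs => rw [hDA]
      rw [hDmul, hDmul]; simp only [abs_mul_abs_self]
    rw [traceNorm, h2, CFC.sqrt_mul_self _ (hDpos _ fun i => abs_nonneg _).nonneg, hWA]

theorem exists_traceNorm_dominating {A : Matrix κ κ ℂ} (hA : A.IsHermitian) :
    ∃ H : Matrix κ κ ℂ, A ≤ H ∧ -A ≤ H ∧ traceNorm A = H.trace.re := by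
  obtain ⟨W, -, -, -, h1, h2, h'⟩ := exists_sign hA
  exact ⟨W * A, h1, h2, h'⟩

/-- With `W` the sign of `A`, both `1 + W` and `1 - W` are positive, being half their own squares.
Pairing them with `A ≤ H` and `-A ≤ H` and adding gives `tr (W A) ≤ tr H`. With
`exists_traceNorm_dominating`, the trace norm becomes a minimum of traces, from which its convexity
follows. -/
theorem traceNorm_le_trace {A H : Matrix κ κ ℂ} (hA : A.IsHermitian) (h₁ : A ≤ H) (h₂ : -A ≤ H) :
    traceNorm A ≤ H.trace.re := by
  obtain ⟨W, hW, hW2, -, -, -, h'⟩ := exists_sign hA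
  have hp : ((1 : Matrix κ κ ℂ) + W).PosSemidef := by
    have h := (posSemidef_self_mul_conjTranspose ((1 : Matrix κ κ ℂ) + W)).smul
      (show (0 : ℝ) ≤ 1 / 2 by norm_num)
    have e : ((1 : Matrix κ κ ℂ) + W) * ((1 : Matrix κ κ ℂ) + W)ᴴ = (2 : ℝ) • (1 + W) := by
      rw [conjTranspose_add, hW.eq, conjTranspose_one]
      simp only [Matrix.add_mul, Matrix.mul_add, hW2, Matrix.one_mul, Matrix.mul_one]
      module
    rw [e, smul_smul] at h
    simpa using h
  have hm : ((1 : Matrix κ κ ℂ) - W).PosSemidef := by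
    have h := (posSemidef_self_mul_conjTranspose ((1 : Matrix κ κ ℂ) - W)).smul
      (show (0 : ℝ) ≤ 1 / 2 by norm_num)
    have e : ((1 : Matrix κ κ ℂ) - W) * ((1 : Matrix κ κ ℂ) - W)ᴴ = (2 : ℝ) • (1 - W) := by
      rw [conjTranspose_sub, hW.eq, conjTranspose_one]
      simp only [Matrix.sub_mul, Matrix.mul_sub, hW2, Matrix.one_mul, Matrix.mul_one]
      module
    rw [e, smul_smul] at h
    simpa using h
  have a1 := trace_mul_re_mono hp h₁
  have a2 := trace_mul_re_mono hm h₂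
  simp only [Matrix.add_mul, Matrix.sub_mul, Matrix.one_mul, Matrix.mul_neg, Matrix.trace_add,
    Matrix.trace_sub, Matrix.trace_neg, Complex.add_re, Complex.sub_re, Complex.neg_re] at a1 a2
  rw [h']
  linarith

theorem traceNorm_sum_le {α : Type*} (s : Finset α) (c : α → ℝ) (A : α → Matrix κ κ ℂ)
    (hc : ∀ i ∈ s, 0 ≤ c i) (hA : ∀ i ∈ s, (A i).IsHermitian) :
    traceNorm (∑ i ∈ s, c i • A i) ≤ ∑ i ∈ s, c i * traceNorm (A i) := by
  classical
  have : ∀ i, ∃ H : Matrix κ κ ℂ, i ∈ s → A i ≤ H ∧ -A i ≤ H ∧ traceNorm (A i) = H.trace.re := by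
    intro i
    by_cases hi : i ∈ s
    · obtain ⟨H, h⟩ := exists_traceNorm_dominating (hA i hi)
      exact ⟨H, fun _ => h⟩
    · exact ⟨0, fun h => absurd h hi⟩
  choose H hH using this
  have hherm : (∑ i ∈ s, c i • A i).IsHermitian := by
    rw [IsHermitian, conjTranspose_sum]
    refine Finset.sum_congr rfl fun i hi => ?_
    rw [conjTranspose_smul, (hA i hi).eq, star_trivial]
  have hle : ∀ (B C : Matrix κ κ ℂ) (r : ℝ), 0 ≤ r → B ≤ C → r • B ≤ r • C := by
    intro B C r hr h
    rw [Matrix.le_iff, ← smul_sub]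
    exact (Matrix.le_iff.mp h).smul hr
  refine (traceNorm_le_trace (H := ∑ i ∈ s, c i • H i) hherm ?_ ?_).trans (le_of_eq ?_)
  · exact Finset.sum_le_sum fun i hi => hle _ _ _ (hc i hi) (hH i hi).1
  · rw [← Finset.sum_neg_distrib]
    refine Finset.sum_le_sum fun i hi => ?_
    rw [← smul_neg]
    exact hle _ _ _ (hc i hi) (hH i hi).2.1
  · rw [Matrix.trace_sum, Complex.re_sum]
    refine Finset.sum_congr rfl fun i hi => ?_
    rw [(hH i hi).2.2]
    simp

theorem traceNorm_zero : traceNorm (0 : Matrix κ κ ℂ) = 0 := by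
  simp [traceNorm]

theorem traceNorm_add_le {A B : Matrix κ κ ℂ} (hA : A.IsHermitian) (hB : B.IsHermitian) :
    traceNorm (A + B) ≤ traceNorm A + traceNorm B := by
  have := traceNorm_sum_le (Finset.univ : Finset Bool) (fun _ => 1) (fun b => if b then A else B)
    (by simp) (by rintro (_ | _) - <;> simpa)
  simpa using this

theorem traceNorm_smul_le {A : Matrix κ κ ℂ} (hA : A.IsHermitian) {c : ℝ} (hc : 0 ≤ c) :
    traceNorm (c • A) ≤ c * traceNorm A := by
  have := traceNorm_sum_le (Finset.univ : Finset Unit) (fun _ => c) (fun _ => A)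
    (by simpa) (by simpa)
  simpa using this

/-- A Cauchy–Schwarz inequality weighted by `s`, in linearised form: expand `0 ≤ tr (M s⁻¹ M s⁻¹)`
for `M = A - t s W s`, where `W` is the sign of `A`. The cross terms give the trace norm. -/
theorem traceNorm_mul_le {A s : Matrix κ κ ℂ} (hA : A.IsHermitian) (hs : s.PosDef) (t : ℝ) :
    2 * t * traceNorm A ≤ (A * s⁻¹ * (A * s⁻¹)).trace.re + t ^ 2 * (s * s).trace.re := by
  obtain ⟨W, hW, hW2, -, -, -, h'⟩ := exists_sign hA
  have hsi : s⁻¹ * s = 1 := Matrix.nonsing_inv_mul _ ((Matrix.isUnit_iff_isUnit_det _).mp hs.isUnit)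
  have hsi' : s * s⁻¹ = 1 := Matrix.mul_nonsing_inv _ ((Matrix.isUnit_iff_isUnit_det _).mp hs.isUnit)
  have hsH := hs.isHermitian.eq
  have key : ∀ M : Matrix κ κ ℂ, M.IsHermitian → 0 ≤ (M * s⁻¹ * (M * s⁻¹)).trace.re := by
    intro M hM
    have h1 := hs.inv.posSemidef.mul_mul_conjTranspose_same M
    rw [hM.eq] at h1
    have := trace_mul_re_nonneg h1 hs.inv.posSemidef
    simpa only [Matrix.mul_assoc] using this
  have hM : (A - t • (s * W * s)).IsHermitian := by
    rw [IsHermitian, conjTranspose_sub, conjTranspose_smul, hA.eq, conjTranspose_mul,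
      conjTranspose_mul, hsH, hW.eq, star_trivial, Matrix.mul_assoc]
  have k1 := key _ hM
  have e1 : (A - t • (s * W * s)) * s⁻¹ = A * s⁻¹ - t • (s * W) := by
    rw [Matrix.sub_mul, Matrix.smul_mul, Matrix.mul_assoc (s * W), hsi', Matrix.mul_one]
  have e2 : (A * s⁻¹ * (s * W)).trace = (W * A).trace := by
    rw [← Matrix.mul_assoc, Matrix.mul_assoc A, hsi, Matrix.mul_one, Matrix.trace_mul_comm]
  have e3 : (s * W * (A * s⁻¹)).trace = (W * A).trace := by
    rw [Matrix.trace_mul_comm, e2]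
  -- This is nonnegativity of the squared Hilbert–Schmidt norm of `W s W - s`.
  have k2 : (s * W * (s * W)).trace.re ≤ (s * s).trace.re := by
    have hP : (W * s * W - s).IsHermitian := by
      rw [IsHermitian, conjTranspose_sub, conjTranspose_mul, conjTranspose_mul, hsH, hW.eq,
        Matrix.mul_assoc]
    have h := (Complex.nonneg_iff.mp
      (posSemidef_self_mul_conjTranspose (W * s * W - s)).trace_nonneg).1
    rw [hP.eq] at h
    have f1 : (W * s * W * (W * s * W)).trace = (s * s).trace := by
      rw [show W * s * W * (W * s * W) = W * (s * (W * W) * s * W) by simp only [Matrix.mul_assoc],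
        Matrix.trace_mul_comm, hW2, Matrix.mul_one, Matrix.mul_assoc, hW2, Matrix.mul_one]
    have f2 : (W * s * W * s).trace = (s * W * (s * W)).trace := by
      rw [Matrix.trace_mul_comm]; simp only [Matrix.mul_assoc]
    have f3 : (s * (W * s * W)).trace = (s * W * (s * W)).trace := by
      simp only [Matrix.mul_assoc]
    simp only [Matrix.sub_mul, Matrix.mul_sub, Matrix.trace_sub, f1, f2, f3, Complex.sub_re] at h
    linarith
  rw [e1] at k1
  simp only [Matrix.sub_mul, Matrix.mul_sub, Matrix.trace_sub, Matrix.smul_mul, Matrix.mul_smul,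
    Matrix.trace_smul, e2, e3, Complex.sub_re, Complex.smul_re, smul_eq_mul] at k1
  rw [h']
  nlinarith [sq_nonneg t]

end TraceNorm

/-! ### Leftover hashing against quantum side information -/

section LeftoverHash

open scoped MatrixOrder

open Matrix

variable {ι : Type}

theorem isHermitian_sum_smul {X : Type*} (s : Finset X) (c : X → ℝ) {R : X → Matrix ι ι ℂ}
    (hR : ∀ x, (R x).IsHermitian) : (∑ x ∈ s, c x • R x).IsHermitian := by
  rw [IsHermitian, conjTranspose_sum]
  refine Finset.sum_congr rfl fun i _ => ?_
  rw [conjTranspose_smul, (hR i).eq, star_trivial]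

theorem posSemidef_sum_of_forall {X : Type*} (s : Finset X) {R : X → Matrix ι ι ℂ}
    (hR : ∀ x, (R x).PosSemidef) : (∑ x ∈ s, R x).PosSemidef :=
  posSemidef_sum s fun x _ => hR x

variable [Fintype ι] [DecidableEq ι]

/-- Conjugating the bound on `B` by `s⁻¹` gives `s⁻¹ B s⁻¹ ≤ μ`, which is then paired with `A ≥ 0`.
-/
theorem trace_mul_inv_mul_inv_le {A B s : Matrix ι ι ℂ} {μ : ℝ} (hA : A.PosSemidef)
    (hs : s.PosDef) (hB : B ≤ μ • (s * s)) :
    (A * s⁻¹ * (B * s⁻¹)).trace.re ≤ μ * A.trace.re := by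
  have hsi : s⁻¹ * s = 1 := Matrix.nonsing_inv_mul _ ((Matrix.isUnit_iff_isUnit_det _).mp hs.isUnit)
  have hsi' : s * s⁻¹ = 1 := Matrix.mul_nonsing_inv _ ((Matrix.isUnit_iff_isUnit_det _).mp hs.isUnit)
  have h := (Matrix.le_iff.mp hB).mul_mul_conjTranspose_same s⁻¹
  rw [hs.inv.isHermitian.eq, Matrix.mul_sub, Matrix.sub_mul, Matrix.mul_smul, Matrix.smul_mul,
    ← Matrix.mul_assoc s⁻¹ s s, hsi, Matrix.one_mul, hsi'] at h
  have h2 := trace_mul_re_nonneg hA h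
  rw [Matrix.mul_sub, Matrix.trace_sub, Matrix.mul_smul, Matrix.mul_one, Matrix.trace_smul,
    Complex.sub_re, Complex.smul_re, smul_eq_mul] at h2
  have e : A * s⁻¹ * (B * s⁻¹) = A * (s⁻¹ * B * s⁻¹) := by simp only [Matrix.mul_assoc]
  rw [e]; linarith

theorem trace_mul_inv_mul_inv_nonneg {A B s : Matrix ι ι ℂ} (hA : A.PosSemidef)
    (hB : B.PosSemidef) (hs : s.PosDef) : 0 ≤ (A * s⁻¹ * (B * s⁻¹)).trace.re := by
  have h := hB.mul_mul_conjTranspose_same s⁻¹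
  rw [hs.inv.isHermitian.eq] at h
  have e : A * s⁻¹ * (B * s⁻¹) = A * (s⁻¹ * B * s⁻¹) := by simp only [Matrix.mul_assoc]
  rw [e]; exact trace_mul_re_nonneg hA h

/-- The sum over all seeds `y` of the trace distance (without the factor `1 / 2`) of `f X y` from
a uniform element, given the quantum system, in the state `∑ x, |x⟩⟨x| ⊗ R x`. -/
noncomputable def hashDistance {X Y Z : Type*} [Fintype X] [Fintype Y] [Fintype Z] [DecidableEq Z]
    (f : X → Y → Z) (R : X → Matrix ι ι ℂ) : ℝ :=
  ∑ y, ∑ z, traceNorm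
    (∑ x, ((if f x y = z then 1 else 0) - (Fintype.card Z : ℝ)⁻¹) • R x)

variable {X Y Z : Type*} [Fintype Y] [Fintype Z] [DecidableEq Z]

theorem sum_centered_mul_centered (f : X → Y → Z) (x x' : X) :
    ∑ y, ∑ z, (((if f x y = z then 1 else 0) - (Fintype.card Z : ℝ)⁻¹) *
      ((if f x' y = z then 1 else 0) - (Fintype.card Z : ℝ)⁻¹)) =
    ((Finset.univ.filter fun y => f x y = f x' y).card : ℝ) -
      Fintype.card Y * (Fintype.card Z : ℝ)⁻¹ := by
  have : ∀ y, ∑ z, (((if f x y = z then 1 else 0) - (Fintype.card Z : ℝ)⁻¹) *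
      ((if f x' y = z then 1 else 0) - (Fintype.card Z : ℝ)⁻¹)) =
      (if f x y = f x' y then 1 else 0) - (Fintype.card Z : ℝ)⁻¹ := by
    intro y
    have hZ : (Fintype.card Z : ℝ) ≠ 0 := by
      have : Nonempty Z := ⟨f x y⟩
      exact_mod_cast Fintype.card_ne_zero
    simp only [sub_mul, mul_sub, Finset.sum_sub_distrib, ite_mul, one_mul, zero_mul,
      Finset.sum_ite_eq, Finset.mem_univ, if_true, mul_ite, mul_one, mul_zero, Finset.sum_const,
      Finset.card_univ, nsmul_eq_mul]
    rw [← mul_assoc, mul_inv_cancel₀ hZ]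
    simp only [eq_comm]
    ring
  simp only [this, Finset.sum_sub_distrib, Finset.sum_boole, Finset.sum_const, Finset.card_univ,
    nsmul_eq_mul]

variable [Fintype X] [DecidableEq X]

/-- Cauchy–Schwarz turns the distance into a quadratic form in the `R x`, whose coefficients, summed
over `y` and `z`, count collisions. Off-diagonal terms see only the excess `η` and are controlled
through `ν`; diagonal terms are controlled through `μ`. The parameter `u` balances the two sides of
Cauchy–Schwarz. -/
theorem hashDistance_le (f : X → Y → Z) {R : X → Matrix ι ι ℂ} {s : Matrix ι ι ℂ} {η μ ν u : ℝ}
    (hR : ∀ x, (R x).PosSemidef) (hs : s.PosDef) (hμ : ∀ x, R x ≤ μ • (s * s))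
    (hν : ∑ x, R x ≤ ν • (s * s)) (hη : 0 ≤ η) (hu : 0 < u)
    (hf : ∀ x x', x ≠ x' → ((Finset.univ.filter fun y => f x y = f x' y).card : ℝ) ≤
      (1 + η) / Fintype.card Z * Fintype.card Y) :
    hashDistance f R ≤ Fintype.card Y * ((∑ x, R x).trace.re * (η * ν + μ * Fintype.card Z) / (2 * u)
      + u * (s * s).trace.re / 2) := by
  rcases isEmpty_or_nonempty Z with hZ | hZ
  · rcases isEmpty_or_nonempty X with hX | hX
    · have h1 : 0 ≤ (s * s).trace.re := trace_mul_re_nonneg hs.posSemidef hs.posSemidef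
      simp only [hashDistance, Finset.univ_eq_empty, Finset.sum_empty, Finset.sum_const_zero]
      simp only [trace_zero, Complex.zero_re, zero_mul, zero_div, zero_add]
      positivity
    · have : IsEmpty Y := ⟨fun y => hZ.elim (f hX.some y)⟩
      simp [hashDistance]
  set K : ℝ := (Fintype.card Z : ℝ) with hK
  set N : ℝ := (Fintype.card Y : ℝ) with hN
  have hKpos : 0 < K := by rw [hK]; exact_mod_cast Fintype.card_pos
  have hN0 : 0 ≤ N := by rw [hN]; positivity
  set q : X → X → ℝ := fun x x' => (R x * s⁻¹ * (R x' * s⁻¹)).trace.re with hq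
  have hq0 : ∀ x x', 0 ≤ q x x' := fun x x' => trace_mul_inv_mul_inv_nonneg (hR x) (hR x') hs
  set c : Y → Z → X → ℝ := fun y z x => (if f x y = z then 1 else 0) - K⁻¹ with hc
  set T : ℝ := (s * s).trace.re with hT
  have hQ : ∀ y z, ((∑ x, c y z x • R x) * s⁻¹ * ((∑ x, c y z x • R x) * s⁻¹)).trace.re =
      ∑ x, ∑ x', c y z x * c y z x' * q x x' := by
    intro y z
    simp only [Matrix.sum_mul, Matrix.mul_sum, Matrix.trace_sum, Complex.re_sum, Matrix.smul_mul,
      Matrix.mul_smul, Matrix.trace_smul, Complex.smul_re, smul_eq_mul]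
    rw [Finset.sum_comm]
    simp only [Finset.mul_sum]
    refine Finset.sum_congr rfl fun x _ => Finset.sum_congr rfl fun x' _ => ?_
    rw [hq]; ring
  have htot : ∑ y, ∑ z, ∑ x, ∑ x', c y z x * c y z x' * q x x' ≤
      N * ((∑ x, R x).trace.re * (η * ν + μ * K)) / K := by
    have e1 : ∑ y, ∑ z, ∑ x, ∑ x', c y z x * c y z x' * q x x' =
        ∑ x, ∑ x', (∑ y, ∑ z, c y z x * c y z x') * q x x' := by
      simp only [Finset.sum_mul]
      calc _ = ∑ y, ∑ x, ∑ z, ∑ x', c y z x * c y z x' * q x x' :=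
            Finset.sum_congr rfl fun y _ => Finset.sum_comm
        _ = ∑ x, ∑ y, ∑ z, ∑ x', c y z x * c y z x' * q x x' := Finset.sum_comm
        _ = ∑ x, ∑ y, ∑ x', ∑ z, c y z x * c y z x' * q x x' :=
            Finset.sum_congr rfl fun x _ => Finset.sum_congr rfl fun y _ => Finset.sum_comm
        _ = _ := Finset.sum_congr rfl fun x _ => Finset.sum_comm
    have e2 : ∀ x x', (∑ y, ∑ z, c y z x * c y z x') * q x x' ≤
        N * η / K * q x x' + if x = x' then N * q x x' else 0 := by
      intro x x'
      have := sum_centered_mul_centered f x x'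
      rw [← hK, ← hN] at this
      rw [show ∑ y, ∑ z, c y z x * c y z x' = _ from this]
      by_cases hx : x = x'
      · subst hx
        rw [if_pos rfl]
        simp only [Finset.filter_true, Finset.card_univ]
        rw [← hN]
        have h1 : 0 ≤ N * η / K * q x x := mul_nonneg (by positivity) (hq0 x x)
        have h2 : 0 ≤ N * K⁻¹ * q x x := mul_nonneg (by positivity) (hq0 x x)
        linarith
      · rw [if_neg hx, add_zero]
        refine mul_le_mul_of_nonneg_right ?_ (hq0 x x')
        have := hf x x' hx
        calc _ ≤ (1 + η) / K * N - N * K⁻¹ := by linarith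
          _ = N * η / K := by field_simp; ring
    have e3 : ∑ x, ∑ x', q x x' ≤ ν * (∑ x, R x).trace.re := by
      have h1 := trace_mul_inv_mul_inv_le (posSemidef_sum_of_forall Finset.univ hR) hs hν
      refine le_trans (le_of_eq ?_) h1
      simp only [Matrix.sum_mul, Matrix.mul_sum, Matrix.trace_sum, Complex.re_sum]
      rw [Finset.sum_comm]
    have e4 : ∑ x, q x x ≤ μ * (∑ x, R x).trace.re := by
      rw [Matrix.trace_sum, Complex.re_sum, Finset.mul_sum]
      exact Finset.sum_le_sum fun x _ => trace_mul_inv_mul_inv_le (hR x) hs (hμ x)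
    rw [e1]
    calc _ ≤ ∑ x, ∑ x', (N * η / K * q x x' + if x = x' then N * q x x' else 0) :=
          Finset.sum_le_sum fun x _ => Finset.sum_le_sum fun x' _ => e2 x x'
      _ = N * η / K * ∑ x, ∑ x', q x x' + N * ∑ x, q x x := by
          simp only [Finset.sum_add_distrib, Finset.sum_ite_eq, Finset.mem_univ, if_true,
            Finset.mul_sum]
      _ ≤ N * η / K * (ν * (∑ x, R x).trace.re) + N * (μ * (∑ x, R x).trace.re) := by
          gcongr
      _ = _ := by field_simp
  -- Cauchy–Schwarz is applied to each of the `K` outputs, hence with parameter `u / K`.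
  have ht : 0 < u / K := by positivity
  have hpt : ∀ y z, traceNorm (∑ x, c y z x • R x) ≤
      (∑ x, ∑ x', c y z x * c y z x' * q x x') / (2 * (u / K)) + u / K * T / 2 := by
    intro y z
    have h := traceNorm_mul_le (isHermitian_sum_smul Finset.univ (c y z) fun x => (hR x).isHermitian)
      hs (u / K)
    rw [hQ y z] at h
    have h2 : traceNorm (∑ x, c y z x • R x) ≤
        (∑ x, ∑ x', c y z x * c y z x' * q x x' + (u / K) ^ 2 * T) / (2 * (u / K)) := by
      rw [le_div_iff₀ (by positivity)]; linarith
    refine h2.trans (le_of_eq ?_)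
    field_simp
  calc hashDistance f R = ∑ y, ∑ z, traceNorm (∑ x, c y z x • R x) := rfl
    _ ≤ ∑ y, ∑ z, ((∑ x, ∑ x', c y z x * c y z x' * q x x') / (2 * (u / K)) + u / K * T / 2) :=
        Finset.sum_le_sum fun y _ => Finset.sum_le_sum fun z _ => hpt y z
    _ = (∑ y, ∑ z, ∑ x, ∑ x', c y z x * c y z x' * q x x') / (2 * (u / K)) +
          N * (K * (u / K * T / 2)) := by
        simp only [Finset.sum_add_distrib, Finset.sum_div, Finset.sum_const, Finset.card_univ,
          nsmul_eq_mul, hN, hK]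
    _ ≤ (N * ((∑ x, R x).trace.re * (η * ν + μ * K)) / K) / (2 * (u / K)) +
          N * (K * (u / K * T / 2)) := by
        gcongr
    _ = _ := by field_simp

theorem exists_posDef_mul_self_eq {σ : Matrix ι ι ℂ} (hσ : σ.PosDef) :
    ∃ s : Matrix ι ι ℂ, s.PosDef ∧ s * s = σ := by
  have h := CFC.sqrt_mul_sqrt_self σ hσ.posSemidef.nonneg
  refine ⟨CFC.sqrt σ, ?_, h⟩
  rw [(CFC.sqrt_nonneg σ).posSemidef.posDef_iff_det_ne_zero]
  intro h0
  have h1 := hσ.det_pos.ne'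
  rw [← h, Matrix.det_mul, h0, mul_zero] at h1
  exact h1 rfl

/-- Classical side information with `w` values costs a factor `w` in the entropy bound. The weights
`σ / w + P g`, where `P g` is the part of the state with `G = g`, dominate both `R x` (up to the
factor `l w`) and `P g`, and their traces sum to at most `2`. -/
theorem sum_hashDistance_le {W : Type*} [Fintype W] [DecidableEq W] (f : X → Y → Z) (G : X → W)
    {R : X → Matrix ι ι ℂ} {σ : Matrix ι ι ℂ} {η l θ : ℝ} (hR : ∀ x, (R x).PosSemidef)
    (hσ : σ.PosDef) (hσ1 : σ.trace.re ≤ 1) (hl : ∀ x, R x ≤ l • σ) (hl0 : 0 ≤ l)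
    (hR1 : (∑ x, R x).trace.re ≤ 1) (hη : 0 ≤ η) (hθ : 0 < θ)
    (hf : ∀ x x', x ≠ x' → ((Finset.univ.filter fun y => f x y = f x' y).card : ℝ) ≤
      (1 + η) / Fintype.card Z * Fintype.card Y)
    (hbound : η + l * Fintype.card Z * Fintype.card W ≤ θ ^ 2) :
    ∑ g, hashDistance f (fun x => if G x = g then R x else 0) ≤ Fintype.card Y * (2 * θ) := by
  rcases isEmpty_or_nonempty W with hW | hW
  · simp only [Finset.univ_eq_empty, Finset.sum_empty]; positivity
  set w : ℝ := (Fintype.card W : ℝ) with hw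
  have hwpos : 0 < w := by rw [hw]; exact_mod_cast Fintype.card_pos
  set P : W → Matrix ι ι ℂ := fun g => ∑ x, if G x = g then R x else 0 with hP
  have hRg : ∀ g x, (if G x = g then R x else 0).PosSemidef := by
    intro g x; split_ifs
    · exact hR x
    · exact PosSemidef.zero
  have hPpos : ∀ g, (P g).PosSemidef := fun g => posSemidef_sum_of_forall Finset.univ (hRg g)
  have hPsum : ∑ g, (P g).trace.re = (∑ x, R x).trace.re := by
    rw [← Complex.re_sum, ← Matrix.trace_sum]
    simp only [hP]
    rw [Finset.sum_comm]
    simp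
  have key : ∀ g, hashDistance f (fun x => if G x = g then R x else 0) ≤
      Fintype.card Y * ((P g).trace.re * θ ^ 2 / (2 * θ) + θ * (w⁻¹ + (P g).trace.re) / 2) := by
    intro g
    have hpd : (w⁻¹ • σ + P g).PosDef := (hσ.smul (inv_pos.mpr hwpos)).add_posSemidef (hPpos g)
    obtain ⟨s, hs, hss⟩ := exists_posDef_mul_self_eq hpd
    have h := hashDistance_le f (η := η) (μ := l * w) (ν := 1) (u := θ) (hRg g) hs ?_ ?_ hη hθ hf
    · refine h.trans ?_
      have hp0 : 0 ≤ (P g).trace.re := (Complex.nonneg_iff.mp (hPpos g).trace_nonneg).1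
      have ht : (s * s).trace.re ≤ w⁻¹ + (P g).trace.re := by
        rw [hss, Matrix.trace_add, Matrix.trace_smul, Complex.add_re, Complex.smul_re, smul_eq_mul]
        have := mul_le_mul_of_nonneg_left hσ1 (inv_pos.mpr hwpos).le
        linarith
      have hb : η * 1 + l * w * Fintype.card Z ≤ θ ^ 2 := by
        calc _ = η + l * Fintype.card Z * w := by ring
          _ ≤ _ := hbound
      change _ * ((P g).trace.re * _ / _ + _) ≤ _
      gcongr
    · intro x
      rw [hss, smul_add, smul_smul, mul_assoc, mul_inv_cancel₀ hwpos.ne', mul_one]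
      have h2 : (0 : Matrix ι ι ℂ) ≤ (l * w) • P g :=
        ((hPpos g).smul (mul_nonneg hl0 hwpos.le)).nonneg
      split_ifs
      · exact (hl x).trans (le_add_of_nonneg_right h2)
      · exact add_nonneg (hσ.posSemidef.smul hl0).nonneg h2
    · rw [hss, one_smul]
      exact le_add_of_nonneg_left (hσ.posSemidef.smul (inv_pos.mpr hwpos).le).nonneg
  refine (Finset.sum_le_sum fun g _ => key g).trans ?_
  rw [← Finset.mul_sum]
  refine mul_le_mul_of_nonneg_left ?_ (by positivity)
  have e : ∀ g, (P g).trace.re * θ ^ 2 / (2 * θ) + θ * (w⁻¹ + (P g).trace.re) / 2 =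
      θ * (P g).trace.re + θ * w⁻¹ / 2 := by
    intro g; field_simp; ring
  simp only [e, Finset.sum_add_distrib, ← Finset.mul_sum, hPsum, Finset.sum_const, Finset.card_univ,
    nsmul_eq_mul]
  rw [← hw, show w * (θ * w⁻¹ / 2) = θ / 2 by field_simp]
  nlinarith

end LeftoverHash

/-! ### Hybrid argument and splitting of seeds -/

section Hybrid

open Matrix

variable {ι : Type} [Fintype ι] [DecidableEq ι]
variable {X Y Z Z' V W : Type*} [Fintype X] [Fintype Y] [Fintype Z] [Fintype Z'] [Fintype V]
  [Fintype W] [DecidableEq Z] [DecidableEq Z'] [DecidableEq W]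

theorem hashDistance_equiv_comp (e : Z ≃ Z') (f : X → Y → Z) (R : X → Matrix ι ι ℂ) :
    hashDistance (fun x y => e (f x y)) R = hashDistance f R := by
  unfold hashDistance
  refine Finset.sum_congr rfl fun y _ => ?_
  rw [← e.sum_comp]
  simp only [EmbeddingLike.apply_eq_iff_eq, Fintype.card_congr e]

/-- The trace distance of `g X y` from a uniform element, given the system and `f X y`. -/
noncomputable def conditionalDistance (f : X → Y → Z) (g : X → Y → Z') (R : X → Matrix ι ι ℂ) : ℝ :=
  ∑ y, ∑ z, ∑ z', traceNorm (∑ x, ((if g x y = z' then 1 else 0) - (Fintype.card Z' : ℝ)⁻¹) •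
    (if f x y = z then R x else 0))

/-- Triangle inequality through the intermediate state in which the second output is replaced by a
uniform one. -/
theorem hashDistance_prod_le [Nonempty Z'] (f : X → Y → Z) (g : X → Y → Z')
    {R : X → Matrix ι ι ℂ} (hR : ∀ x, (R x).IsHermitian) :
    hashDistance (fun x y => (f x y, g x y)) R ≤
      hashDistance f R + conditionalDistance f g R := by
  have hK : (Fintype.card Z' : ℝ) ≠ 0 := by exact_mod_cast Fintype.card_ne_zero
  unfold hashDistance conditionalDistance
  rw [← Finset.sum_add_distrib]
  refine Finset.sum_le_sum fun y _ => ?_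
  rw [Fintype.sum_prod_type, ← Finset.sum_add_distrib]
  refine Finset.sum_le_sum fun z _ => ?_
  set A : Matrix ι ι ℂ :=
    ∑ x, ((if f x y = z then 1 else 0) - (Fintype.card Z : ℝ)⁻¹) • R x with hA
  have hAh : A.IsHermitian := isHermitian_sum_smul _ _ hR
  have h1 : traceNorm A = ∑ _z' : Z', (Fintype.card Z' : ℝ)⁻¹ * traceNorm A := by
    rw [Finset.sum_const, Finset.card_univ, nsmul_eq_mul, ← mul_assoc, mul_inv_cancel₀ hK, one_mul]
  rw [h1, ← Finset.sum_add_distrib]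
  refine Finset.sum_le_sum fun z' _ => ?_
  set B : Matrix ι ι ℂ := ∑ x, ((if g x y = z' then 1 else 0) - (Fintype.card Z' : ℝ)⁻¹) •
    (if f x y = z then R x else 0) with hB
  have hBh : B.IsHermitian := isHermitian_sum_smul _ _ fun x => by
    split_ifs
    · exact hR x
    · exact isHermitian_zero
  have e : ∑ x, ((if (f x y, g x y) = (z, z') then 1 else 0) -
      (Fintype.card (Z × Z') : ℝ)⁻¹) • R x = (Fintype.card Z' : ℝ)⁻¹ • A + B := by
    rw [hA, hB, Finset.smul_sum, ← Finset.sum_add_distrib]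
    refine Finset.sum_congr rfl fun x _ => ?_
    rw [Fintype.card_prod, Nat.cast_mul, mul_inv, smul_smul]
    by_cases h : f x y = z <;> by_cases h' : g x y = z' <;> simp [h, h'] <;> module
  rw [e]
  refine (traceNorm_add_le (by rw [IsHermitian, conjTranspose_smul, hAh.eq, star_trivial])
    hBh).trans ?_
  gcongr
  exact traceNorm_smul_le hAh (by positivity)

/-- Coarse-graining classical side information does not increase the trace distance. -/
theorem sum_traceNorm_coarsen_le (G : X → W) (φ : W → Z) (a : X → ℝ) {R : X → Matrix ι ι ℂ}
    (hR : ∀ x, (R x).IsHermitian) :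
    ∑ z, traceNorm (∑ x, a x • (if φ (G x) = z then R x else 0)) ≤
      ∑ g, traceNorm (∑ x, a x • (if G x = g then R x else 0)) := by
  have hH : ∀ g, (∑ x, a x • (if G x = g then R x else 0)).IsHermitian := fun g =>
    isHermitian_sum_smul _ _ fun x => by
      split_ifs
      · exact hR x
      · exact isHermitian_zero
  have e : ∀ z, ∑ x, a x • (if φ (G x) = z then R x else 0) =
      ∑ g, (if φ g = z then (1 : ℝ) else 0) • ∑ x, a x • (if G x = g then R x else 0) := by
    intro z
    simp only [Finset.smul_sum]
    rw [Finset.sum_comm]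
    refine Finset.sum_congr rfl fun x _ => ?_
    rw [Finset.sum_eq_single (G x)]
    · by_cases h : φ (G x) = z <;> simp [h]
    · intro g _ hg; simp [Ne.symm hg]
    · simp
  have h : ∀ z, traceNorm (∑ x, a x • (if φ (G x) = z then R x else 0)) ≤
      ∑ g, (if φ g = z then (1 : ℝ) else 0) *
        traceNorm (∑ x, a x • (if G x = g then R x else 0)) := by
    intro z
    rw [e z]
    exact traceNorm_sum_le _ _ _ (fun g _ => by split_ifs <;> simp) (fun g _ => hH g)
  refine (Finset.sum_le_sum fun z _ => h z).trans (le_of_eq ?_)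
  rw [Finset.sum_comm]
  refine Finset.sum_congr rfl fun g _ => ?_
  rw [← Finset.sum_mul]
  simp

/-- If, on the part `v` of the seed, `g` is the function `C` and `f` is determined by `v` and the
value of `G y`, then the distance of `g` from uniform given `f` is that of `C` given `G y`. -/
theorem conditionalDistance_le (f : X → Y → Z) (g : X → Y → Z') (C : X → V → Z')
    (upd : Y → V → Y) (G : Y → X → W) (φ : Y → V → W → Z) {R : X → Matrix ι ι ℂ} {B : ℝ}
    (hR : ∀ x, (R x).IsHermitian)
    (hupd : ∀ F : Y → ℝ, Fintype.card V * ∑ y, F y = ∑ y, ∑ v, F (upd y v))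
    (hg : ∀ x y v, g x (upd y v) = C x v) (hf : ∀ x y v, f x (upd y v) = φ y v (G y x))
    [Nonempty V]
    (hB : ∀ y, ∑ w, hashDistance C (fun x => if G y x = w then R x else 0) ≤
      Fintype.card V * B) :
    conditionalDistance f g R ≤ Fintype.card Y * B := by
  have hV : (0 : ℝ) < Fintype.card V := by exact_mod_cast Fintype.card_pos
  refine le_of_mul_le_mul_left ?_ hV
  unfold conditionalDistance
  rw [hupd]
  have : ∀ y, ∑ v, ∑ z, ∑ z', traceNorm (∑ x, ((if g x (upd y v) = z' then 1 else 0) -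
      (Fintype.card Z' : ℝ)⁻¹) • (if f x (upd y v) = z then R x else 0)) ≤
      Fintype.card V * B := by
    intro y
    refine le_trans ?_ (hB y)
    unfold hashDistance
    rw [Finset.sum_comm (s := (Finset.univ : Finset W))]
    refine Finset.sum_le_sum fun v _ => ?_
    rw [Finset.sum_comm, Finset.sum_comm (s := (Finset.univ : Finset W))]
    refine Finset.sum_le_sum fun z' _ => ?_
    simp only [hg, hf]
    -- For fixed `y` and `v`, the value of `f` is a function of `G y x`, so revealing `G y x`
    -- instead can only increase the distance.
    exact sum_traceNorm_coarsen_le (G y) (φ y v) _ hR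
  refine (Finset.sum_le_sum fun y _ => this y).trans (le_of_eq ?_)
  rw [Finset.sum_const, Finset.card_univ, nsmul_eq_mul]
  ring

theorem hashDistance_of_unique [Unique Z] (f : X → Y → Z) (R : X → Matrix ι ι ℂ) :
    hashDistance f R = 0 := by
  unfold hashDistance
  refine Finset.sum_eq_zero fun y _ => Finset.sum_eq_zero fun z _ => ?_
  have : ∀ x, f x y = z := fun x => Subsingleton.elim _ _
  simp [this, traceNorm_zero]

/-- Induction on the number of bits, splitting off the last one each time: each bit is compared with
uniform given the bits before it. -/
theorem hashDistance_bits_le {m : ℕ} (b : Fin m → X → Y → Bool) {R : X → Matrix ι ι ℂ}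
    (hR : ∀ x, (R x).IsHermitian) :
    hashDistance (fun x y i => b i x y) R ≤
      ∑ i : Fin m, conditionalDistance (fun x y (j : Fin i) => b (Fin.castLE i.is_lt.le j) x y)
        (b i) R := by
  induction m with
  | zero => rw [hashDistance_of_unique]; simp
  | succ m ih =>
    rw [Fin.sum_univ_castSucc]
    have h := hashDistance_prod_le (fun x y (i : Fin m) => b i.castSucc x y) (b (Fin.last m)) hR
    have e := hashDistance_equiv_comp ((Fin.snocEquiv fun _ : Fin (m + 1) => Bool))
      (fun x y => (b (Fin.last m) x y, fun i : Fin m => b i.castSucc x y)) R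
    have e' := hashDistance_equiv_comp (Equiv.prodComm Bool (Fin m → Bool))
      (fun x y => (b (Fin.last m) x y, fun i : Fin m => b i.castSucc x y)) R
    have hs : ∀ x y, Fin.snocEquiv (fun _ : Fin (m + 1) => Bool)
        (b (Fin.last m) x y, fun i : Fin m => b i.castSucc x y) = fun i => b i x y := by
      intro x y
      ext i
      refine Fin.lastCases ?_ (fun i => ?_) i <;> simp [Fin.snocEquiv]
    simp only [hs] at e
    simp only [Equiv.prodComm_apply, Prod.swap_prod_mk] at e'
    rw [e, ← e']
    refine h.trans (add_le_add (ih fun i => b i.castSucc) (le_of_eq rfl))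

end Hybrid

/-! ### From the output state to hash distances -/

section OutputState

open Matrix
open scoped MatrixOrder

variable {ι κ : Type} [DecidableEq κ]

theorem posSemidef_single (z : κ) : (Matrix.single z z (1 : ℂ)).PosSemidef := by
  rw [← Matrix.diagonal_single]
  refine PosSemidef.diagonal fun i => ?_
  by_cases h : i = z
  · subst h; simp
  · simp [h]

theorem isHermitian_single_kronecker (z : κ) {A : Matrix ι ι ℂ} (hA : A.IsHermitian) :
    (Matrix.single z z (1 : ℂ) ⊗ₖ A).IsHermitian := by
  rw [IsHermitian, conjTranspose_kronecker, hA.eq, (posSemidef_single z).isHermitian.eq]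

/-- The embedding `B ↦ |z⟩⟨z| ⊗ |y⟩⟨y| ⊗ B`. -/
def classicalEmbedding {α β : Type} [DecidableEq α] [DecidableEq β] (z : α) (y : β) :
    Matrix ι ι ℂ →ₗ[ℂ] Matrix (α × β × ι) (α × β × ι) ℂ where
  toFun B := Matrix.single z z (1 : ℂ) ⊗ₖ (Matrix.single y y (1 : ℂ) ⊗ₖ B)
  map_add' A B := by simp only [kronecker_add]
  map_smul' c A := by simp only [kronecker_smul, RingHom.id_apply]

/-- Output and seed are classical, so the difference is block diagonal. Its trace norm is then
bounded block by block, which yields `hashDistance` divided by the number of seeds. -/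
theorem outputState_sub_eq {n d m : ℕ} (E : BitString n → BitString d → BitString m)
    (ρ : Matrix (BitString n × ι) (BitString n × ι) ℂ) :
    outputState E ρ - maxMixed (BitString m) ⊗ₖ (maxMixed (BitString d) ⊗ₖ reducedRight ρ) =
      ∑ p : BitString m × BitString d, (((2 : ℝ) ^ d)⁻¹) • classicalEmbedding p.1 p.2
        (∑ x, ((if E x p.2 = p.1 then 1 else 0) - (Fintype.card (BitString m) : ℝ)⁻¹) •
          block ρ x) := by
  have h1 : outputState E ρ = ∑ z : BitString m, ∑ y : BitString d, ∑ x,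
      (((2 : ℂ) ^ d)⁻¹ * if E x y = z then 1 else 0) • classicalEmbedding z y (block ρ x) := by
    rw [outputState, Finset.sum_comm, Finset.sum_comm (s := (Finset.univ : Finset (BitString m)))]
    refine Finset.sum_congr rfl fun y _ => ?_
    rw [Finset.sum_comm (s := (Finset.univ : Finset (BitString m)))]
    refine Finset.sum_congr rfl fun x _ => ?_
    rw [Finset.sum_eq_single (E x y)]
    · simp [classicalEmbedding]
    · intro z _ hz; simp [Ne.symm hz]
    · simp
  have h2 : maxMixed (BitString m) ⊗ₖ (maxMixed (BitString d) ⊗ₖ reducedRight ρ) =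
      ∑ z : BitString m, ∑ y : BitString d, ∑ x,
        (((2 : ℂ) ^ d)⁻¹ * (Fintype.card (BitString m) : ℂ)⁻¹) •
          classicalEmbedding z y (block ρ x) := by
    simp only [maxMixed, reducedRight, smul_kronecker, kronecker_smul, smul_smul]
    rw [← Matrix.sum_single_one (m := BitString m), ← Matrix.sum_single_one (m := BitString d)]
    have : ∀ (A : Matrix ι ι ℂ), (∑ z : BitString m, Matrix.single z z (1 : ℂ)) ⊗ₖ
        ((∑ z : BitString d, Matrix.single z z (1 : ℂ)) ⊗ₖ A) =
        ∑ z : BitString m, ∑ y : BitString d, classicalEmbedding z y A := by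
      intro A
      ext ⟨z, y, i⟩ ⟨z', y', j⟩
      simp only [kroneckerMap_apply, Matrix.sum_apply, classicalEmbedding, LinearMap.coe_mk,
        AddHom.coe_mk, Finset.sum_mul, Finset.mul_sum]
      rw [Finset.sum_comm]
    rw [this]
    simp only [map_sum, Finset.smul_sum]
    have hc : (Fintype.card (BitString d) : ℂ) = 2 ^ d := by simp
    rw [hc, mul_comm]
  rw [h1, h2, Fintype.sum_prod_type]
  simp only [← Finset.sum_sub_distrib, ← sub_smul, map_sum, Finset.smul_sum]
  refine Finset.sum_congr rfl fun z _ => Finset.sum_congr rfl fun y _ =>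
    Finset.sum_congr rfl fun x _ => ?_
  rw [← Complex.coe_smul, ← Complex.coe_smul, map_smul, smul_smul]
  congr 1
  push_cast
  split_ifs
  · simp; ring
  · simp

variable [Fintype ι] [DecidableEq ι] [Fintype κ]

theorem traceNorm_single_kronecker_le (z : κ) {A : Matrix ι ι ℂ} (hA : A.IsHermitian) :
    traceNorm (Matrix.single z z (1 : ℂ) ⊗ₖ A) ≤ traceNorm A := by
  obtain ⟨H, h1, h2, h3⟩ := exists_traceNorm_dominating hA
  rw [h3]
  refine (traceNorm_le_trace (H := Matrix.single z z (1 : ℂ) ⊗ₖ H)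
    (isHermitian_single_kronecker z hA) ?_ ?_).trans (le_of_eq ?_)
  · have := (posSemidef_single z).kronecker (Matrix.le_iff.mp h1)
    rwa [sub_eq_add_neg, kronecker_add, ← neg_one_smul ℂ A, kronecker_smul, neg_one_smul,
      ← sub_eq_add_neg] at this
  · have := (posSemidef_single z).kronecker (Matrix.le_iff.mp h2)
    rw [Matrix.le_iff, sub_neg_eq_add]
    rwa [sub_neg_eq_add, kronecker_add] at this
  · rw [trace_kronecker]; simp [Matrix.trace_single_eq_same]

theorem traceNorm_outputState_sub_le {n d m : ℕ} (E : BitString n → BitString d → BitString m)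
    (ρ : Matrix (BitString n × ι) (BitString n × ι) ℂ) (hρ : ∀ x, (block ρ x).IsHermitian) :
    traceNorm (outputState E ρ -
      maxMixed (BitString m) ⊗ₖ (maxMixed (BitString d) ⊗ₖ reducedRight ρ)) ≤
      ((2 : ℝ) ^ d)⁻¹ * hashDistance E (block ρ) := by
  rw [outputState_sub_eq]
  have hh : ∀ p : BitString m × BitString d, (∑ x, ((if E x p.2 = p.1 then 1 else 0) -
      (Fintype.card (BitString m) : ℝ)⁻¹) • block ρ x).IsHermitian := fun p =>
    isHermitian_sum_smul _ _ hρ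
  refine (traceNorm_sum_le _ _ _ (fun _ _ => by positivity) fun p _ =>
    isHermitian_single_kronecker _ (isHermitian_single_kronecker _ (hh p))).trans ?_
  rw [← Finset.mul_sum, hashDistance, Fintype.sum_prod_type, Finset.sum_comm]
  gcongr with y _ z _
  exact (traceNorm_single_kronecker_le _ (isHermitian_single_kronecker _ (hh (z, y)))).trans
    (traceNorm_single_kronecker_le _ (hh (z, y)))

end OutputState

/-! ### Trevisan's construction and the composition -/

section Trevisan

open Matrix
open scoped MatrixOrder

variable {n t d m : ℕ}

/-- The seed `y` with the bits at the positions in `S` replaced by `v`. -/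
def overwrite (S : Finset (Fin d)) (hS : S.card = t) (y : BitString d) (v : BitString t) :
    BitString d :=
  fun p => if h : p ∈ S then v ((S.orderIsoOfFin hS).symm ⟨p, h⟩) else y p

theorem overwrite_orderEmbOfFin (S : Finset (Fin d)) (hS : S.card = t) (y : BitString d)
    (v : BitString t) (k : Fin t) : overwrite S hS y v (S.orderEmbOfFin hS k) = v k := by
  have h : S.orderEmbOfFin hS k ∈ S := S.orderEmbOfFin_mem hS k
  rw [overwrite, dif_pos h]
  congr 1
  rw [OrderIso.symm_apply_eq]
  ext
  simp

theorem overwrite_overwrite (S : Finset (Fin d)) (hS : S.card = t) (y : BitString d)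
    (v : BitString t) :
    overwrite S hS (overwrite S hS y v) (fun k => y (S.orderEmbOfFin hS k)) = y := by
  ext p
  by_cases h : p ∈ S
  · rw [overwrite, dif_pos h, ← Finset.coe_orderIsoOfFin_apply, OrderIso.apply_symm_apply]
  · rw [overwrite, dif_neg h, overwrite, dif_neg h]

/-- Exchanging the selected part of `y` with `v` is an involution of `Y × V`, hence preserves sums
over all pairs. -/
theorem card_mul_sum_eq_of_involutive {Y V : Type*} [Fintype Y] [Fintype V] (upd : Y → V → Y)
    (get : Y → V) (h : ∀ y v, upd (upd y v) (get y) = y) (h' : ∀ y v, get (upd y v) = v)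
    (F : Y → ℝ) : Fintype.card V * ∑ y, F y = ∑ y, ∑ v, F (upd y v) := by
  have hinv : Function.Involutive fun p : Y × V => (upd p.1 p.2, get p.1) := fun p => by
    simp [h, h']
  have := Equiv.sum_comp hinv.toPerm (fun p : Y × V => F p.1)
  simp only [Function.Involutive.coe_toPerm, Fintype.sum_prod_type] at this
  rw [this]
  simp only [Finset.sum_const, Finset.card_univ, nsmul_eq_mul, Finset.mul_sum]

theorem sum_castLE_eq_sum_filter {m : ℕ} (i : Fin m) (F : Fin m → ℝ) :
    ∑ j : Fin i, F (Fin.castLE i.is_lt.le j) = ∑ j ∈ Finset.univ.filter (fun j => j < i), F j := by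
  refine Finset.sum_bij (fun j _ => Fin.castLE i.is_lt.le j) ?_ ?_ ?_ ?_
  · intro j _
    simp only [Finset.mem_filter, Finset.mem_univ, true_and]
    exact j.is_lt
  · intro a _ b _ hab
    exact Fin.castLE_injective _ hab
  · intro b hb
    simp only [Finset.mem_filter, Finset.mem_univ, true_and] at hb
    exact ⟨⟨b, hb⟩, Finset.mem_univ _, rfl⟩
  · intro j _; rfl

variable {ι : Type} [Fintype ι] [DecidableEq ι]

theorem hashDistance_trevisan_le (C : BitString n → BitString t → Bool)
    (S : Fin m → Finset (Fin d)) (hS : IsWeakDesign t 1 S) {R : BitString n → Matrix ι ι ℂ}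
    {σ : Matrix ι ι ℂ} {η l θ : ℝ} (hR : ∀ x, (R x).PosSemidef)
    (hσ : σ.PosDef) (hσ1 : σ.trace.re ≤ 1) (hl : ∀ x, R x ≤ l • σ) (hl0 : 0 ≤ l)
    (hR1 : (∑ x, R x).trace.re ≤ 1) (hη : 0 ≤ η) (hθ : 0 < θ)
    (hC : ∀ x x', x ≠ x' → ((Finset.univ.filter fun y => C x y = C x' y).card : ℝ) ≤
      (1 + η) / 2 * 2 ^ t)
    (hbound : η + l * 2 * 2 ^ m ≤ θ ^ 2) :
    hashDistance (trevisan C S hS.card_eq) R ≤ 2 ^ d * (m * (2 * θ)) := by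
  have hcard : ∀ k : ℕ, (Fintype.card (BitString k) : ℝ) = 2 ^ k := fun k => by simp
  refine (hashDistance_bits_le (fun i x y => trevisan C S hS.card_eq x y i)
    fun x => (hR x).isHermitian).trans ?_
  have key : ∀ i : Fin m, conditionalDistance
      (fun x y (j : Fin i) => trevisan C S hS.card_eq x y (Fin.castLE i.is_lt.le j))
      (fun x y => trevisan C S hS.card_eq x y i) R ≤ 2 ^ d * (2 * θ) := by
    intro i
    let c : Fin i → Fin m := Fin.castLE i.is_lt.le
    -- One truth table per earlier bit `j`: with the seed outside `S i` fixed, that bit is a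
    -- function of the seed on `S j ∩ S i`. The weak design bounds the total number of table entries
    -- by `m`.
    let W : Type := (j : Fin i) → ((↥(S (c j) ∩ S i) → Bool) → Bool)
    let G : BitString d → BitString n → W := fun y x j u =>
      C x fun k => if h : (S (c j)).orderEmbOfFin (hS.card_eq _) k ∈ S i then
        u ⟨_, Finset.mem_inter.mpr ⟨Finset.orderEmbOfFin_mem _ _ k, h⟩⟩
      else y ((S (c j)).orderEmbOfFin (hS.card_eq _) k)
    let φ : BitString d → BitString t → W → (Fin i → Bool) := fun _ v w j =>
      w j fun p => v (((S i).orderIsoOfFin (hS.card_eq i)).symm ⟨p, (Finset.mem_inter.mp p.2).2⟩)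
    have hW : (Fintype.card W : ℝ) ≤ 2 ^ m := by
      have h1 : Fintype.card W = ∏ j : Fin i, 2 ^ 2 ^ (S (c j) ∩ S i).card := by
        simp only [W, Fintype.card_pi, Finset.prod_const, Fintype.card_bool, Finset.card_univ,
          Fintype.card_coe]
      have h2 : ∑ j : Fin i, 2 ^ (S (c j) ∩ S i).card ≤ m := by
        have := hS.overlap i
        rw [one_mul, ← sum_castLE_eq_sum_filter i (fun j => (2 : ℝ) ^ (S j ∩ S i).card)] at this
        exact_mod_cast this
      rw [h1, Finset.prod_pow_eq_pow_sum]
      exact_mod_cast Nat.pow_le_pow_right (by norm_num) h2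
    have h := conditionalDistance_le (B := 2 * θ)
      (fun x y (j : Fin i) => trevisan C S hS.card_eq x y (Fin.castLE i.is_lt.le j))
      (fun x y => trevisan C S hS.card_eq x y i) C (overwrite (S i) (hS.card_eq i)) G φ
      (fun x => (hR x).isHermitian)
      (card_mul_sum_eq_of_involutive _ (fun y k => y ((S i).orderEmbOfFin (hS.card_eq i) k))
        (overwrite_overwrite _ _) (fun y v => funext (overwrite_orderEmbOfFin _ _ y v))) ?_ ?_ ?_
    · rwa [hcard] at h
    · intro x y v
      simp only [trevisan, overwrite_orderEmbOfFin]
    · intro x y v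
      rfl
    · intro y
      refine sum_hashDistance_le C (G y) hR hσ hσ1 hl hl0 hR1 hη hθ ?_ ?_
      · simpa using hC
      · refine le_trans ?_ hbound
        have : (Fintype.card Bool : ℝ) = 2 := by simp
        rw [this]
        gcongr
  refine (Finset.sum_le_sum fun i _ => key i).trans (le_of_eq ?_)
  rw [Finset.sum_const, Finset.card_univ, nsmul_eq_mul, Fintype.card_fin]
  ring

/-- The two seeds are independent, so the second function is a hash applied to a source with the
first output, one of `2 ^ m₁` values, as side information. -/
theorem hashDistance_compose_le {d₁ d₂ m₁ m₂ : ℕ} (E₁ : BitString n → BitString d₁ → BitString m₁)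
    (E₂ : BitString n → BitString d₂ → BitString m₂) {R : BitString n → Matrix ι ι ℂ}
    {σ : Matrix ι ι ℂ} {η l θ B : ℝ} (hR : ∀ x, (R x).PosSemidef)
    (hσ : σ.PosDef) (hσ1 : σ.trace.re ≤ 1) (hl : ∀ x, R x ≤ l • σ) (hl0 : 0 ≤ l)
    (hR1 : (∑ x, R x).trace.re ≤ 1) (hη : 0 ≤ η) (hθ : 0 < θ)
    (hE : ∀ x x', x ≠ x' → ((Finset.univ.filter fun y => E₂ x y = E₂ x' y).card : ℝ) ≤
      (1 + η) / 2 ^ m₂ * 2 ^ d₂)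
    (hbound : η + l * 2 ^ m₂ * 2 ^ m₁ ≤ θ ^ 2)
    (hB : hashDistance E₁ R ≤ 2 ^ d₁ * B) :
    hashDistance (compose E₁ E₂) R ≤ 2 ^ (d₁ + d₂) * (B + 2 * θ) := by
  have hcard : ∀ k : ℕ, (Fintype.card (BitString k) : ℝ) = 2 ^ k := fun k => by simp
  let left : BitString (d₁ + d₂) → BitString d₁ := fun y i => y (Fin.castAdd d₂ i)
  let right : BitString (d₁ + d₂) → BitString d₂ := fun y i => y (Fin.natAdd d₁ i)
  have hleft : ∀ u v, left (Fin.append u v) = u := fun u v => by ext i; simp [left]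
  have hright : ∀ u v, right (Fin.append u v) = v := fun u v => by ext i; simp [right]
  have happ : ∀ y, Fin.append (left y) (right y) = y := fun y => Fin.append_castAdd_natAdd
  have e := hashDistance_equiv_comp (Fin.appendEquiv m₁ m₂)
    (fun x y => (E₁ x (left y), E₂ x (right y))) R
  have e' : hashDistance (compose E₁ E₂) R =
      hashDistance (fun x y => (E₁ x (left y), E₂ x (right y))) R := e ▸ rfl
  have h1 : hashDistance (fun x y => E₁ x (left y)) R = 2 ^ d₂ * hashDistance E₁ R := by
    unfold hashDistance
    rw [← (Fin.appendEquiv d₁ d₂).sum_comp, Fintype.sum_prod_type, Finset.mul_sum]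
    refine Finset.sum_congr rfl fun y _ => ?_
    have : ∀ v, left (Fin.appendEquiv d₁ d₂ (y, v)) = y := fun v => hleft y v
    simp only [this, Finset.sum_const, Finset.card_univ, nsmul_eq_mul, hcard]
  have h2 := conditionalDistance_le (B := 2 * θ) (fun x y => E₁ x (left y))
    (fun x y => E₂ x (right y)) E₂ (fun y v => Fin.append (left y) v)
    (fun y x => E₁ x (left y)) (fun _ _ w => w) (fun x => (hR x).isHermitian)
    (card_mul_sum_eq_of_involutive _ right (fun y v => by rw [hleft, happ])
      (fun y v => by rw [hright])) (fun x y v => by rw [hright]) (fun x y v => by rw [hleft])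
    (fun y => sum_hashDistance_le E₂ _ hR hσ hσ1 hl hl0 hR1 hη hθ (by simpa using hE)
      (by simpa using hbound))
  rw [e']
  refine (hashDistance_prod_le _ _ fun x => (hR x).isHermitian).trans ?_
  rw [h1]
  rw [hcard] at h2
  calc _ ≤ 2 ^ d₂ * (2 ^ d₁ * B) + 2 ^ (d₁ + d₂) * (2 * θ) := by gcongr
    _ = _ := by ring

end Trevisan

/-! ### Min-entropy and security -/

section MinEntropy

open Matrix
open scoped MatrixOrder

variable {n d m : ℕ}

/-- The leftover hash lemma inverts its weight. Averaging `σ` with the fully mixed state makes it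
positive definite at the cost of the factor `2`. -/
theorem exists_posDef_of_lt_minEntropy {ι : Type} [Fintype ι] [DecidableEq ι]
    {ρ : Matrix (BitString n × ι) (BitString n × ι) ℂ} {k : ℝ}
    (hk : 0 ≤ k) (h : k < minEntropy ρ) :
    ∃ σ : Matrix ι ι ℂ, σ.PosDef ∧ σ.trace.re ≤ 1 ∧
      ∀ x, block ρ x ≤ (2 * (2 : ℝ) ^ (-k)) • σ := by
  have hne : {l : ℝ | ∃ σ : Matrix ι ι ℂ, IsState σ ∧ ((((2 : ℝ) ^ (-l) : ℝ) : ℂ) •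
      ((1 : Matrix (BitString n) (BitString n) ℂ) ⊗ₖ σ) - ρ).PosSemidef}.Nonempty := by
    -- The real supremum of the empty set is `0`, which contradicts `0 ≤ k < minEntropy ρ`.
    by_contra hne
    rw [minEntropy, Set.not_nonempty_iff_eq_empty.mp hne, Real.sSup_empty] at h
    linarith
  obtain ⟨l, ⟨σ, hσ, hle⟩, hl⟩ := exists_lt_of_lt_csSup hne h
  have hι : Nonempty ι := by
    by_contra hι
    rw [not_nonempty_iff] at hι
    have := hσ.trace_eq_one
    simp [Matrix.trace] at this
  set N : ℝ := (Fintype.card ι : ℝ) with hN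
  have hNpos : 0 < N := by rw [hN]; exact_mod_cast Fintype.card_pos
  have hτ : ((N⁻¹ : ℝ) • (1 : Matrix ι ι ℂ)).PosDef := PosDef.one.smul (inv_pos.mpr hNpos)
  have hτ1 : ((N⁻¹ : ℝ) • (1 : Matrix ι ι ℂ)).trace.re = 1 := by
    rw [Matrix.trace_smul, Matrix.trace_one, Complex.smul_re, Complex.natCast_re, smul_eq_mul,
      ← hN, inv_mul_cancel₀ hNpos.ne']
  refine ⟨(2⁻¹ : ℝ) • ((N⁻¹ : ℝ) • 1 + σ), ?_, ?_, ?_⟩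
  · exact (hτ.add_posSemidef hσ.posSemidef).smul (by norm_num)
  · rw [Matrix.trace_smul, Matrix.trace_add, Complex.smul_re, Complex.add_re, hτ1,
      hσ.trace_eq_one]
    norm_num
  · intro x
    have h1 : block ρ x ≤ ((2 : ℝ) ^ (-l)) • σ := by
      have h2 := hle.submatrix (fun i : ι => (x, i))
      rw [Matrix.le_iff]
      have e : ((2 : ℝ) ^ (-l)) • σ - block ρ x = ((((2 : ℝ) ^ (-l) : ℝ) : ℂ) •
          ((1 : Matrix (BitString n) (BitString n) ℂ) ⊗ₖ σ) - ρ).submatrix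
            (fun i => (x, i)) (fun i => (x, i)) := by
        ext i j
        simp [block]
      rw [e]
      exact h2
    have h3 : (2 : ℝ) ^ (-l) ≤ (2 : ℝ) ^ (-k) :=
      Real.rpow_le_rpow_of_exponent_le (by norm_num) (by linarith)
    rw [smul_smul, mul_right_comm, mul_inv_cancel₀ two_ne_zero, one_mul, smul_add]
    refine h1.trans (le_trans ?_ (le_add_of_nonneg_left
      (hτ.posSemidef.smul (Real.rpow_nonneg (by norm_num) _)).nonneg))
    rw [Matrix.le_iff, ← sub_smul]
    exact hσ.posSemidef.smul (sub_nonneg.mpr h3)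

theorem block_posSemidef {ι : Type} {ρ : Matrix (BitString n × ι) (BitString n × ι) ℂ}
    (hρ : ρ.PosSemidef) (x : BitString n) : (block ρ x).PosSemidef :=
  hρ.submatrix _

theorem trace_sum_block {ι : Type} [Fintype ι] (ρ : Matrix (BitString n × ι) (BitString n × ι) ℂ) :
    (∑ x, block ρ x).trace = ρ.trace := by
  rw [Matrix.trace_sum]
  simp [Matrix.trace, block, Fintype.sum_prod_type]

/-- Security of the composition of Trevisan's extractor with a hashing extractor. -/
theorem isQuantumProofStrongExtractor_compose {t d₁ d₂ m₁ m₂ : ℕ}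
    (C : BitString n → BitString t → Bool) (S : Fin m₁ → Finset (Fin d₁))
    (hS : IsWeakDesign t 1 S) (E₂ : BitString n → BitString d₂ → BitString m₂)
    {γ η k θ₁ θ₂ : ℝ} (hγ : 0 ≤ γ) (hη : 0 ≤ η) (hθ₁ : 0 < θ₁) (hθ₂ : 0 < θ₂) (hk : 0 ≤ k)
    (hC : ∀ x x', x ≠ x' → ((Finset.univ.filter fun y => C x y = C x' y).card : ℝ) ≤
      (1 + γ) / 2 * 2 ^ t)
    (hE : ∀ x x', x ≠ x' → ((Finset.univ.filter fun y => E₂ x y = E₂ x' y).card : ℝ) ≤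
      (1 + η) / 2 ^ m₂ * 2 ^ d₂)
    (h₁ : γ + 2 * (2 : ℝ) ^ (-k) * 2 * 2 ^ m₁ ≤ θ₁ ^ 2)
    (h₂ : η + 2 * (2 : ℝ) ^ (-k) * 2 ^ m₂ * 2 ^ m₁ ≤ θ₂ ^ 2) :
    IsQuantumProofStrongExtractor (k + 1) (m₁ * θ₁ + θ₂)
      (compose (trevisan C S hS.card_eq) E₂) := by
  intro ι _ _ ρ hρ _ hent
  -- The supremum need not be attained; the extra bit in `k + 1` provides the strict inequality.
  obtain ⟨σ, hσ, hσ1, hl⟩ := exists_posDef_of_lt_minEntropy hk (by linarith)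
  have hR := block_posSemidef hρ.posSemidef
  have hR1 : (∑ x, block ρ x).trace.re ≤ 1 := by
    rw [trace_sum_block, hρ.trace_eq_one]; simp
  have hl0 : 0 ≤ 2 * (2 : ℝ) ^ (-k) := by positivity
  have hT := hashDistance_trevisan_le C S hS hR hσ hσ1 hl hl0 hR1 hγ hθ₁ hC h₁
  have h := hashDistance_compose_le _ E₂ hR hσ hσ1 hl hl0 hR1 hη hθ₂ hE h₂ hT
  have h' := traceNorm_outputState_sub_le (compose (trevisan C S hS.card_eq) E₂) ρ
    fun x => (hR x).isHermitian
  have h3 : ((2 : ℝ) ^ (d₁ + d₂))⁻¹ * hashDistance (compose (trevisan C S hS.card_eq) E₂) (block ρ)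
      ≤ m₁ * (2 * θ₁) + 2 * θ₂ := by
    rw [inv_mul_le_iff₀ (by positivity)]
    exact h
  linarith

end MinEntropy

/-! ### Polynomial hashing and list decoding -/

section Hashing

open Polynomial

/-- The polynomial with coefficients the bits of `x`. -/
noncomputable def bitPolynomial (F : Type*) [Field F] {n : ℕ} (x : BitString n) : F[X] :=
  ∑ i : Fin n, C (if x i then (1 : F) else 0) * X ^ (i : ℕ)

theorem coeff_bitPolynomial (F : Type*) [Field F] {n : ℕ} (x : BitString n) (i : Fin n) :
    (bitPolynomial F x).coeff i = if x i then 1 else 0 := by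
  rw [bitPolynomial, finsetSum_coeff, Finset.sum_eq_single i]
  · rw [coeff_C_mul_X_pow, if_pos rfl]
  · intro j _ hj
    rw [coeff_C_mul_X_pow, if_neg]
    exact fun h => hj (Fin.ext h.symm)
  · simp

theorem card_eval_eq_le (F : Type*) [Field F] [Fintype F] [DecidableEq F] {n : ℕ}
    {x x' : BitString n} (h : x ≠ x') :
    (Finset.univ.filter fun a : F =>
      (bitPolynomial F x).eval a = (bitPolynomial F x').eval a).card ≤ n := by
  obtain ⟨i, hi⟩ := Function.ne_iff.mp h
  have hne : bitPolynomial F x - bitPolynomial F x' ≠ 0 := by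
    intro h0
    have := congrArg (fun p => p.coeff (i : ℕ)) h0
    simp only [coeff_sub, coeff_bitPolynomial, coeff_zero] at this
    cases hx : x i <;> cases hx' : x' i <;> simp_all
  have hdeg : (bitPolynomial F x - bitPolynomial F x').degree < n := by
    refine (degree_sub_le _ _).trans_lt (max_lt ?_ ?_) <;> exact degree_sum_fin_lt _
  have hnat : (bitPolynomial F x - bitPolynomial F x').natDegree ≤ n :=
    natDegree_le_of_degree_le hdeg.le
  refine le_trans ?_ hnat
  refine card_le_degree_of_subset_roots fun a ha => ?_
  rw [Finset.mem_val, Finset.mem_filter] at ha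
  rw [mem_roots hne, IsRoot.def, eval_sub, ha.2, sub_self]

/-- Over the field with `2 ^ s` elements, the seed `(a, b)` sends `x` to the first `m` coordinates
of `p_x(a) * b`. A collision occurs either because `a` is a root of `p_x - p_x'`, which has at most
`n` roots, or because multiplication by a nonzero element sends `b` into a subspace of size `2 ^ (s
- m)`. -/
theorem exists_hash_family (n : ℕ) {m s : ℕ} (hs : s ≠ 0) (hm : m ≤ s) :
    ∃ E : BitString n → BitString (s + s) → BitString m, ∀ x x', x ≠ x' →
      (Finset.univ.filter fun y => E x y = E x' y).card ≤ n * 2 ^ s + 2 ^ s * 2 ^ (s - m) := by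
  classical
  obtain ⟨r, rfl⟩ := Nat.exists_eq_add_of_le hm
  let F := GaloisField 2 (m + r)
  have : Fintype F := Fintype.ofFinite F
  have hF : Fintype.card F = 2 ^ (m + r) := by
    rw [← Nat.card_eq_fintype_card]; exact GaloisField.card 2 _ hs
  have e : F ≃ₗ[ZMod 2] (Fin (m + r) → ZMod 2) :=
    LinearEquiv.ofFinrankEq _ _ (by rw [GaloisField.finrank 2 hs, Module.finrank_fin_fun])
  have ψ : BitString ((m + r) + (m + r)) ≃ F × F :=
    Fintype.equivOfCardEq (by simp [hF, pow_add])
  refine ⟨fun x y i => decide (e ((bitPolynomial F x).eval (ψ y).1 * (ψ y).2)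
    (Fin.castAdd r i) = 1), fun x x' hx => ?_⟩
  have hdec : ∀ u v : ZMod 2, decide (u = 1) = decide (v = 1) → u = v := by decide
  let p : F → F := fun a => (bitPolynomial F x).eval a - (bitPolynomial F x').eval a
  let A : Finset (F × F) := (Finset.univ.filter fun a => p a = 0) ×ˢ Finset.univ
  let B : Finset (F × F) := (Finset.univ : Finset F).biUnion fun a =>
    (Finset.univ.filter fun b => p a ≠ 0 ∧ ∀ i, e (p a * b) (Fin.castAdd r i) = 0).map
      ⟨fun b => (a, b), Prod.mk_right_injective a⟩
  have hA : A.card ≤ n * 2 ^ (m + r) := by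
    rw [Finset.card_product, Finset.card_univ, hF]
    refine Nat.mul_le_mul_right _ (le_trans (le_of_eq ?_) (card_eval_eq_le F hx))
    simp only [p, sub_eq_zero]
  have hB : B.card ≤ 2 ^ (m + r) * 2 ^ r := by
    refine Finset.card_biUnion_le.trans ?_
    rw [← hF, ← Finset.card_univ, ← smul_eq_mul, ← Finset.sum_const]
    refine Finset.sum_le_sum fun a _ => ?_
    rw [Finset.card_map]
    by_cases ha : p a = 0
    · simp [ha]
    have : Fintype.card (Fin r → ZMod 2) = 2 ^ r := by simp
    rw [← this, ← Finset.card_univ]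
    refine Finset.card_le_card_of_injOn (fun b j => e (p a * b) (Fin.natAdd m j))
      (fun _ _ => Finset.mem_coe.mpr (Finset.mem_univ _)) ?_
    intro b hb b' hb' h
    rw [Finset.mem_coe, Finset.mem_filter] at hb hb'
    refine mul_left_cancel₀ ha (e.injective (funext fun i => ?_))
    refine Fin.addCases (fun i => ?_) (fun j => ?_) i
    · rw [hb.2.2 i, hb'.2.2 i]
    · exact congrFun h j
  rw [Nat.add_sub_cancel_left]
  refine le_trans ?_ (Nat.add_le_add hA hB)
  refine le_trans ?_ (Finset.card_union_le A B)
  refine Finset.card_le_card_of_injOn ψ ?_ ψ.injective.injOn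
  intro y hy
  rw [Finset.mem_coe, Finset.mem_filter] at hy
  rw [Finset.mem_coe, Finset.mem_union]
  by_cases ha : p (ψ y).1 = 0
  · left
    simp only [A, Finset.mem_product, Finset.mem_filter, Finset.mem_univ, true_and, and_true]
    exact ha
  · right
    simp only [B, Finset.mem_biUnion, Finset.mem_map, Finset.mem_filter, Finset.mem_univ, true_and]
    refine ⟨(ψ y).1, (ψ y).2, ⟨ha, fun i => ?_⟩, rfl⟩
    have h := hdec _ _ (congrFun hy.2 i)
    simp only [p]
    rw [sub_mul, map_sub, Pi.sub_apply, h, sub_self]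

/-- The Johnson bound for binary codes. -/
theorem isListDecodable_of_agreement_le {n : ℕ} {κ : Type} [Fintype κ] [Nonempty κ]
    (code : BitString n → κ → Bool) {δ γ : ℝ} (hδ : 0 < δ) (hγδ : γ ≤ δ ^ 2 / 2)
    (h : ∀ x x', x ≠ x' → ((Finset.univ.filter fun v => code x v = code x' v).card : ℝ) ≤
      (1 + γ) / 2 * Fintype.card κ) :
    IsListDecodable code (δ / 2) (4 / δ ^ 2) := by
  classical
  intro w
  set B := Finset.univ.filter fun x : BitString n =>
    (hammingDist (code x) w : ℝ) ≤ (1 / 2 - δ / 2) * (Fintype.card κ : ℝ) with hB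
  set N : ℝ := (Fintype.card κ : ℝ) with hN
  have hNpos : 0 < N := by rw [hN]; exact_mod_cast Fintype.card_pos
  set b : ℝ := (B.card : ℝ) with hb
  have hb0 : 0 ≤ b := by rw [hb]; positivity
  -- Sign vectors of agreement with `w`. Codewords in the ball correlate with `w` by at least `δ N`,
  -- while distinct ones correlate with each other by at most `γ N`; comparing first and second
  -- moments bounds their number.
  let τ : BitString n → κ → ℝ := fun x v => if code x v = w v then 1 else -1
  have hτ1 : ∀ x ∈ B, δ * N ≤ ∑ v, τ x v := by
    intro x hx
    rw [hB, Finset.mem_filter] at hx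
    have e : ∑ v, τ x v = N - 2 * hammingDist (code x) w := by
      have : ∀ v, τ x v = 1 - 2 * (if code x v ≠ w v then 1 else 0) := by
        intro v; by_cases hv : code x v = w v <;> simp [τ, hv]; norm_num
      simp only [this, Finset.sum_sub_distrib, ← Finset.mul_sum, Finset.sum_boole, hammingDist,
        Finset.sum_const, Finset.card_univ, nsmul_eq_mul, mul_one, hN]
    rw [e]; linarith [hx.2]
  have hτ2 : ∀ x x', ∑ v, τ x v * τ x' v =
      2 * ((Finset.univ.filter fun v => code x v = code x' v).card : ℝ) - N := by
    intro x x'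
    have : ∀ v, τ x v * τ x' v = 2 * (if code x v = code x' v then 1 else 0) - 1 := by
      intro v
      simp only [τ]
      cases code x v <;> cases code x' v <;> cases w v <;> norm_num
    simp only [this, Finset.sum_sub_distrib, ← Finset.mul_sum, Finset.sum_boole,
      Finset.sum_const, Finset.card_univ, nsmul_eq_mul, mul_one, hN]
  have hτ3 : ∀ x x', ∑ v, τ x v * τ x' v ≤ δ ^ 2 / 2 * N + if x = x' then N else 0 := by
    intro x x'
    rw [hτ2]
    by_cases hx : x = x'
    · subst hx
      simp only [Finset.filter_true, Finset.card_univ, if_true]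
      rw [← hN]
      nlinarith [sq_nonneg δ]
    · rw [if_neg hx]
      have := h x x' hx
      nlinarith [mul_le_mul_of_nonneg_right hγδ hNpos.le]
  have h1 : b * (δ * N) ≤ ∑ v, ∑ x ∈ B, τ x v := by
    rw [Finset.sum_comm, hb, ← nsmul_eq_mul, ← Finset.sum_const]
    exact Finset.sum_le_sum hτ1
  have h2 : ∑ v, (∑ x ∈ B, τ x v) ^ 2 ≤ b ^ 2 * (δ ^ 2 / 2 * N) + b * N := by
    calc ∑ v, (∑ x ∈ B, τ x v) ^ 2 = ∑ x ∈ B, ∑ x' ∈ B, ∑ v, τ x v * τ x' v := by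
          simp only [sq, Finset.sum_mul_sum]
          rw [Finset.sum_comm]
          exact Finset.sum_congr rfl fun x _ => Finset.sum_comm
      _ ≤ ∑ x ∈ B, ∑ x' ∈ B, (δ ^ 2 / 2 * N + if x = x' then N else 0) :=
          Finset.sum_le_sum fun x _ => Finset.sum_le_sum fun x' _ => hτ3 x x'
      _ = _ := by
          have : ∀ x ∈ B, ∑ x' ∈ B, (δ ^ 2 / 2 * N + if x = x' then N else 0) =
              b * (δ ^ 2 / 2 * N) + N := by
            intro x hx
            rw [Finset.sum_add_distrib, Finset.sum_const, Finset.sum_ite_eq, if_pos hx,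
              nsmul_eq_mul]
          rw [Finset.sum_congr rfl this, Finset.sum_const, nsmul_eq_mul]
          ring
  have h3 : (∑ v, ∑ x ∈ B, τ x v) ^ 2 ≤ N * ∑ v, (∑ x ∈ B, τ x v) ^ 2 := by
    have := sq_sum_le_card_mul_sum_sq (s := (Finset.univ : Finset κ))
      (f := fun v => ∑ x ∈ B, τ x v)
    simpa [hN] using this
  have h4 : (b * (δ * N)) ^ 2 ≤ N * (b ^ 2 * (δ ^ 2 / 2 * N) + b * N) :=
    (pow_le_pow_left₀ (by positivity) h1 2).trans (h3.trans (by gcongr))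
  -- Half of the left side of `h4` absorbs the off-diagonal part, which is where `γ ≤ δ ^ 2 / 2`
  -- enters.
  have h5 : b * (b * δ ^ 2) ≤ b * 2 := by
    have : N ^ 2 * (b * (b * δ ^ 2)) ≤ N ^ 2 * (b * 2) := by nlinarith
    exact le_of_mul_le_mul_left this (by positivity)
  rw [le_div_iff₀ (by positivity)]
  rcases hb0.eq_or_lt with h0 | h0
  · rw [← h0]; norm_num
  · linarith [le_of_mul_le_mul_left h5 h0]

end Hashing

/-! ### Greedy construction of weak designs -/

section WeakDesign

/-- The sum factors over coordinates; in each, one value contributes `2` and the others `1`. -/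
theorem sum_two_pow_agree (t N : ℕ) (g : Fin t → Fin N) :
    ∑ f : Fin t → Fin N, (2 : ℝ) ^ (Finset.univ.filter fun k => g k = f k).card =
      ((N : ℝ) + 1) ^ t := by
  have h : ∀ f : Fin t → Fin N, (2 : ℝ) ^ (Finset.univ.filter fun k => g k = f k).card =
      ∏ k, if g k = f k then 2 else 1 := by
    intro f
    rw [Finset.prod_ite]; simp
  simp only [h]
  rw [← Fintype.piFinset_univ, ← Finset.prod_univ_sum (fun _ => Finset.univ)
    (fun k x => if g k = x then (2 : ℝ) else 1)]
  have : ∀ k, ∑ x : Fin N, (if g k = x then (2 : ℝ) else 1) = N + 1 := by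
    intro k
    have : ∀ x, (if g k = x then (2 : ℝ) else 1) = 1 + if g k = x then 1 else 0 := by
      intro x; split_ifs <;> norm_num
    simp [this, Finset.sum_add_distrib]
  simp [this]

/-- `(1 + 1 / N) ^ t ≤ exp (t / N) ≤ 2`; this is the source of `⌈t / ln 2⌉` in the seed length. -/
theorem add_one_pow_le_two_mul_pow {t N : ℕ} (h : (t : ℝ) / Real.log 2 ≤ N) :
    ((N : ℝ) + 1) ^ t ≤ 2 * (N : ℝ) ^ t := by
  have hlog : 0 < Real.log 2 := Real.log_pos (by norm_num)
  rcases Nat.eq_zero_or_pos t with rfl | ht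
  · norm_num
  have hN : 0 < (N : ℝ) := lt_of_lt_of_le (by positivity) h
  have h1 : ((N : ℝ) + 1) ^ t = (1 / N + 1) ^ t * (N : ℝ) ^ t := by
    rw [← mul_pow]; congr 1; field_simp; ring
  rw [h1]
  refine mul_le_mul_of_nonneg_right ?_ (by positivity)
  calc (1 / (N : ℝ) + 1) ^ t ≤ (Real.exp (1 / N)) ^ t := by
        gcongr; exact Real.add_one_le_exp _
    _ = Real.exp (t / N) := by rw [← Real.exp_nat_mul]; congr 1; ring
    _ ≤ Real.exp (Real.log 2) := by
        rw [Real.exp_le_exp, div_le_iff₀ hN]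
        rw [div_le_iff₀ hlog] at h
        linarith
    _ = 2 := Real.exp_log (by norm_num)

/-- Averaged over all `f`, each `j` contributes at most `2`, so some `f` does no worse than the
average. -/
theorem exists_few_agreements {t N : ℕ} (h : (t : ℝ) / Real.log 2 ≤ N) {α : Type*} (J : Finset α)
    (g : α → Fin t → Fin N) : ∃ f : Fin t → Fin N,
      ∑ j ∈ J, (2 : ℝ) ^ (Finset.univ.filter fun k => g j k = f k).card ≤ 2 * J.card := by
  have hne : Nonempty (Fin t → Fin N) := by
    rcases Nat.eq_zero_or_pos t with rfl | ht
    · exact ⟨Fin.elim0⟩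
    · have hN : 0 < (N : ℝ) :=
        lt_of_lt_of_le (div_pos (by exact_mod_cast ht) (Real.log_pos (by norm_num))) h
      exact ⟨fun _ => ⟨0, by exact_mod_cast hN⟩⟩
  obtain ⟨f, -, hf⟩ := Finset.exists_le_of_sum_le (s := (Finset.univ : Finset (Fin t → Fin N)))
    (f := fun f => ∑ j ∈ J, (2 : ℝ) ^ (Finset.univ.filter fun k => g j k = f k).card)
    (g := fun _ => 2 * (J.card : ℝ)) Finset.univ_nonempty (by
      rw [Finset.sum_comm]
      simp only [sum_two_pow_agree, Finset.sum_const, Finset.card_univ, nsmul_eq_mul,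
        Fintype.card_fun, Fintype.card_fin, Nat.cast_pow]
      have := mul_le_mul_of_nonneg_left (add_one_pow_le_two_mul_pow h) (Nat.cast_nonneg' J.card)
      linarith)
  exact ⟨f, hf⟩

theorem exists_seq_few_agreements {t N : ℕ} (h : (t : ℝ) / Real.log 2 ≤ N) (a : ℕ → ℕ) (m : ℕ) :
    ∃ f : ℕ → Fin t → Fin N, ∀ i < m, ∑ j ∈ (Finset.range i).filter (fun j => a j = a i),
      (2 : ℝ) ^ (Finset.univ.filter fun k => f j k = f i k).card ≤
        2 * ((Finset.range i).filter (fun j => a j = a i)).card := by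
  induction m with
  | zero =>
    obtain ⟨g, -⟩ := exists_few_agreements h (∅ : Finset Empty) (fun e => e.elim)
    exact ⟨fun _ => g, fun i hi => absurd hi (Nat.not_lt_zero i)⟩
  | succ m ih =>
    obtain ⟨f, hf⟩ := ih
    obtain ⟨g, hg⟩ := exists_few_agreements h ((Finset.range m).filter (fun j => a j = a m)) f
    refine ⟨Function.update f m g, fun i hi => ?_⟩
    have hj : ∀ i ≤ m, ∀ j ∈ (Finset.range i).filter (fun j => a j = a i),
        Function.update f m g j = f j := by
      intro i hi j hj
      rw [Finset.mem_filter, Finset.mem_range] at hj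
      exact Function.update_of_ne (by omega) _ _
    rw [Finset.sum_congr rfl fun j hjm => by rw [hj i (by omega) j hjm]]
    rcases Nat.lt_succ_iff_lt_or_eq.mp hi with hi | rfl
    · rw [Function.update_of_ne hi.ne]; exact hf i hi
    · rw [Function.update_self]; exact hg

/-- Such `j` have `m - j` strictly between `m - i` and `2 ^ (a + 1)`, which is at most `2 * (m -
i)`. -/
theorem card_filter_log_eq_lt {m i : ℕ} (hi : i < m) :
    ((Finset.range i).filter fun j => Nat.log 2 (m - j) = Nat.log 2 (m - i)).card < m - i := by
  set a := Nat.log 2 (m - i) with ha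
  have h1 : 2 ^ a ≤ m - i := Nat.pow_log_le_self 2 (by omega)
  have hsub : ((Finset.range i).filter fun j => Nat.log 2 (m - j) = a).card ≤
      (Finset.Ioo (m - i) (2 ^ (a + 1))).card := by
    refine Finset.card_le_card_of_injOn (fun j => m - j) ?_ ?_
    · intro j hj
      rw [Finset.mem_coe, Finset.mem_filter, Finset.mem_range] at hj
      have : m - j < 2 ^ (a + 1) := by
        rw [← hj.2]; exact Nat.lt_pow_succ_log_self (by norm_num) _
      rw [Finset.mem_coe, Finset.mem_Ioo]
      exact ⟨(by omega : m - i < m - j), this⟩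
    · intro j hj j' hj' h
      rw [Finset.mem_coe, Finset.mem_filter, Finset.mem_range] at hj hj'
      simp only at h
      omega
  rw [Nat.card_Ioo, pow_succ] at hsub
  omega

/-- The seed consists of `l` grids of size `t × N`, and `S i` is the graph of a function in the grid
numbered `Nat.log 2 (m - i)`. Sets in different grids are disjoint and contribute `1`; those in the
same grid contribute `2` on average, by the greedy choice. The total is at most `i` plus the number
of earlier sets in the same grid, which is less than `m - i`. -/
theorem exists_weakDesign (t m : ℕ) :
    ∃ S : Fin m → Finset (Fin (t * ⌈(t : ℝ) / Real.log 2⌉₊ * ⌈Real.logb 2 (4 * m)⌉₊)),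
      IsWeakDesign t 1 S := by
  set N := ⌈(t : ℝ) / Real.log 2⌉₊ with hN
  set l := ⌈Real.logb 2 (4 * m)⌉₊ with hl
  obtain ⟨f, hf⟩ := exists_seq_few_agreements (N := N)
    (Nat.le_ceil ((t : ℝ) / Real.log 2)) (fun j => Nat.log 2 (m - j)) m
  have hlog : ∀ i : Fin m, Nat.log 2 (m - i) < l := by
    intro i
    have him := i.is_lt
    have h1 : 2 ^ Nat.log 2 (m - i) ≤ m := (Nat.pow_log_le_self 2 (by omega)).trans (Nat.sub_le _ _)
    have hm : (0 : ℝ) < m := by exact_mod_cast (by omega : 0 < m)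
    rw [hl, Nat.lt_ceil, Real.lt_logb_iff_rpow_lt (by norm_num) (by positivity), Real.rpow_natCast]
    have h2 : ((2 : ℝ) ^ Nat.log 2 (m - i)) ≤ m := by exact_mod_cast h1
    linarith
  let ψ : Fin l × (Fin t × Fin N) ≃ Fin (t * N * l) :=
    Fintype.equivOfCardEq (by simp [mul_comm])
  let pos : Fin m → Fin t → Fin (t * N * l) := fun i k =>
    ψ (⟨Nat.log 2 (m - i), hlog i⟩, k, f i k)
  have hpos : ∀ i j k k', pos i k = pos j k' ↔
      Nat.log 2 (m - i) = Nat.log 2 (m - j) ∧ k = k' ∧ f i k = f j k' := by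
    intro i j k k'
    simp only [pos, EmbeddingLike.apply_eq_iff_eq, Prod.mk.injEq, Fin.mk.injEq]
  let emb : Fin m → Fin t ↪ Fin (t * N * l) := fun i =>
    ⟨pos i, fun k k' h => ((hpos i i k k').mp h).2.1⟩
  refine ⟨fun i => Finset.univ.map (emb i), fun i => by simp, fun i => ?_⟩
  have hinter : ∀ i j : Fin m, Finset.univ.map (emb j) ∩ Finset.univ.map (emb i) =
      (Finset.univ.filter fun k => Nat.log 2 (m - j) = Nat.log 2 (m - i) ∧ f j k = f i k).map
        (emb j) := by
    intro i j
    ext p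
    simp only [Finset.mem_inter, Finset.mem_map, Finset.mem_univ, true_and, Finset.mem_filter]
    constructor
    · rintro ⟨⟨k, rfl⟩, k', hk'⟩
      obtain ⟨h1, rfl, h2⟩ := (hpos _ _ _ _).mp hk'
      exact ⟨k', ⟨h1.symm, h2.symm⟩, rfl⟩
    · rintro ⟨k, ⟨h1, h2⟩, rfl⟩
      exact ⟨⟨k, rfl⟩, k, (hpos _ _ _ _).mpr ⟨h1.symm, rfl, h2.symm⟩⟩
  have hterm : ∀ j : Fin m, (2 : ℝ) ^ (Finset.univ.map (emb j) ∩ Finset.univ.map (emb i)).card =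
      if Nat.log 2 (m - j) = Nat.log 2 (m - i) then
        (2 : ℝ) ^ (Finset.univ.filter fun k => f j k = f i k).card else 1 := by
    intro j
    rw [hinter, Finset.card_map]
    split_ifs with h <;> simp [h]
  simp only [hterm]
  let F : ℕ → ℝ := fun j => if Nat.log 2 (m - j) = Nat.log 2 (m - i) then
        (2 : ℝ) ^ (Finset.univ.filter fun k => f j k = f i k).card else 1
  have hsum : ∑ j ∈ Finset.univ.filter (fun j => j < i), F j = ∑ j ∈ Finset.range i, F j := by
    rw [← sum_castLE_eq_sum_filter i (fun j => F j), Finset.sum_range]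
    rfl
  change ∑ j ∈ Finset.univ.filter (fun j => j < i), F j ≤ _
  rw [hsum, Finset.sum_ite]
  have h1 := hf i i.is_lt
  have h2 := card_filter_log_eq_lt i.is_lt
  have h3 := Finset.card_filter_add_card_filter_not (s := Finset.range i)
    (fun j => Nat.log 2 (m - j) = Nat.log 2 (m - i))
  rw [Finset.card_range] at h3
  rw [Finset.sum_const, nsmul_eq_mul, mul_one, one_mul]
  have h4 := i.is_lt
  have h5 : 2 * ((Finset.range i).filter fun j => Nat.log 2 (m - j) = Nat.log 2 (m - i)).card +
      ((Finset.range i).filter fun j => ¬ Nat.log 2 (m - j) = Nat.log 2 (m - i)).card ≤ m := by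
    omega
  have h6 : 2 * (((Finset.range i).filter fun j =>
      Nat.log 2 (m - j) = Nat.log 2 (m - i)).card : ℝ) + (((Finset.range i).filter fun j =>
      ¬ Nat.log 2 (m - j) = Nat.log 2 (m - i)).card : ℝ) ≤ m := by exact_mod_cast h5
  linarith

end WeakDesign

/-! ### Choice of parameters -/

theorem IsQuantumProofStrongExtractor.mono {n d m : ℕ} {k k' ε ε' : ℝ}
    {E : BitString n → BitString d → BitString m} (h : IsQuantumProofStrongExtractor k ε E)
    (hk : k ≤ k') (hε : ε ≤ ε') : IsQuantumProofStrongExtractor k' ε' E :=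
  fun ι _ _ ρ hρ hc hk' => (h ι ρ hρ hc (hk.trans hk')).trans hε

/-- A hash family whose collision probability exceeds `2 ^ (-m)` by a factor `1 + η` only. -/
theorem exists_almost_universal (n : ℕ) {m s : ℕ} (hs : s ≠ 0) (hm : m ≤ s) {η : ℝ}
    (hη : (n : ℝ) * 2 ^ m ≤ η * 2 ^ s) :
    ∃ E : BitString n → BitString (s + s) → BitString m, ∀ x x', x ≠ x' →
      ((Finset.univ.filter fun y => E x y = E x' y).card : ℝ) ≤ (1 + η) / 2 ^ m * 2 ^ (s + s) := by
  obtain ⟨E, hE⟩ := exists_hash_family n hs hm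
  refine ⟨E, fun x x' hx => ?_⟩
  have h : ((Finset.univ.filter fun y => E x y = E x' y).card : ℝ) ≤
      n * 2 ^ s + 2 ^ s * 2 ^ (s - m) := by exact_mod_cast hE x x' hx
  refine h.trans ?_
  have e : (2 : ℝ) ^ s = 2 ^ (s - m) * 2 ^ m := by rw [← pow_add, Nat.sub_add_cancel hm]
  rw [div_mul_eq_mul_div, le_div_iff₀ (by positivity), pow_add]
  calc ((n : ℝ) * 2 ^ s + 2 ^ s * 2 ^ (s - m)) * 2 ^ m =
        (n * 2 ^ m) * 2 ^ s + 2 ^ s * (2 ^ (s - m) * 2 ^ m) := by ring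
    _ ≤ (η * 2 ^ s) * 2 ^ s + 2 ^ s * 2 ^ s := by rw [← e]; gcongr
    _ = _ := by ring

/-- The total seed length of Trevisan's extractor, for codes of length `2 ^ (2 * s)`, and a hash
family with seeds of `2 * s` bits. -/
theorem seed_length_le {n m m₁ s : ℕ} {ε : ℝ} (hm : 2 ≤ m) (hmn : m ≤ n) (hm₁ : m₁ ≤ m)
    (hε : 0 < ε) (hε1 : ε < 1) (hs : s = ⌈Real.logb 2 (10000 * n * m ^ 4 / ε ^ 4)⌉₊) :
    (((s + s) * ⌈((s + s : ℕ) : ℝ) / Real.log 2⌉₊ * ⌈Real.logb 2 (4 * m₁)⌉₊ + (s + s) : ℕ) : ℝ) ≤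
      13000 * Real.logb 2 (n / ε) ^ 2 * Real.logb 2 m := by
  set L := Real.logb 2 (n / ε) with hL
  set l := Real.logb 2 m with hl
  have hm0 : (2 : ℝ) ≤ m := by exact_mod_cast hm
  have hmn0 : (m : ℝ) ≤ n := by exact_mod_cast hmn
  have hl1 : 1 ≤ l := by
    rw [hl, Real.le_logb_iff_rpow_le (by norm_num) (by linarith), Real.rpow_one]; exact hm0
  have hnε : (n : ℝ) ≤ n / ε := by
    rw [le_div_iff₀ hε]; nlinarith
  have hL1 : 1 ≤ L := by
    rw [hL, Real.le_logb_iff_rpow_le (by norm_num) (by linarith), Real.rpow_one]; linarith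
  have hs1 : (s : ℝ) ≤ 20 * L := by
    -- Uses `10000 ≤ 2 ^ 14`, `m ≤ n` and `ε ^ 5 ≤ ε ^ 4`.
    have h1 : Real.logb 2 (10000 * n * m ^ 4 / ε ^ 4) ≤ 14 + 5 * L := by
      have hpos : 0 < (n : ℝ) / ε := by linarith
      have e : 14 + 5 * L = Real.logb 2 (2 ^ 14 * (n / ε) ^ 5) := by
        rw [Real.logb_mul (by positivity) (by positivity), Real.logb_pow, Real.logb_pow,
          Real.logb_self_eq_one (by norm_num), ← hL]
        norm_num
      rw [e]
      have hn0 : (0 : ℝ) < n := by linarith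
      refine Real.logb_le_logb_of_le (by norm_num) (by positivity) ?_
      rw [div_pow, ← mul_div_assoc, div_le_div_iff₀ (by positivity) (by positivity)]
      have h5 : ε ^ 5 ≤ ε ^ 4 := pow_le_pow_of_le_one hε.le hε1.le (by norm_num)
      calc 10000 * (n : ℝ) * m ^ 4 * ε ^ 5 ≤ 10000 * (n : ℝ) * n ^ 4 * ε ^ 4 := by gcongr
        _ = 10000 * (n ^ 5 * ε ^ 4) := by ring
        _ ≤ 2 ^ 14 * (n ^ 5 * ε ^ 4) := by gcongr; norm_num
        _ = _ := by ring
    have h2 : (s : ℝ) ≤ 14 + 5 * L + 1 := by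
      rw [hs]
      exact (Nat.ceil_le_ceil h1 |> fun h => (Nat.cast_le.mpr h)).trans
        (Nat.ceil_lt_add_one (by linarith)).le
    linarith
  set t : ℝ := ((s + s : ℕ) : ℝ) with ht
  have ht1 : t ≤ 40 * L := by rw [ht]; push_cast; linarith
  have ht0 : 0 ≤ t := by rw [ht]; positivity
  have hln : 1 / 2 < Real.log 2 := by have := Real.log_two_gt_d9; linarith
  have hN : (⌈t / Real.log 2⌉₊ : ℝ) ≤ 81 * L := by
    have h1 : t / Real.log 2 ≤ 80 * L := by
      rw [div_le_iff₀ (by linarith)]; nlinarith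
    exact (Nat.ceil_lt_add_one (by positivity)).le.trans (by linarith)
  have hl4 : (⌈Real.logb 2 (4 * m₁)⌉₊ : ℝ) ≤ 4 * l := by
    rcases Nat.eq_zero_or_pos m₁ with h0 | h0
    · rw [h0]; simp; linarith
    have h1 : Real.logb 2 (4 * m₁) ≤ 2 + l := by
      have e : 2 + l = Real.logb 2 (2 ^ 2 * m) := by
        rw [Real.logb_mul (by positivity) (by positivity), Real.logb_pow,
          Real.logb_self_eq_one (by norm_num), ← hl]
        norm_num
      rw [e]
      have : (0 : ℝ) < m₁ := by exact_mod_cast h0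
      have h2 : (m₁ : ℝ) ≤ m := by exact_mod_cast hm₁
      exact Real.logb_le_logb_of_le (by norm_num) (by positivity) (by linarith)
    exact ((Nat.cast_le.mpr (Nat.ceil_le_ceil h1)).trans
      (Nat.ceil_lt_add_one (by linarith)).le).trans (by linarith)
  rw [Nat.cast_add, Nat.cast_mul, Nat.cast_mul, ← ht]
  -- The constant is `40 * 81 * 4 + 40 = 13000`.
  calc t * (⌈t / Real.log 2⌉₊ : ℝ) * (⌈Real.logb 2 (4 * m₁)⌉₊ : ℝ) + t
      ≤ 40 * L * (81 * L) * (4 * l) + 40 * L * (L * l) := by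
        have h1 : 1 ≤ L * l := by nlinarith
        have h2 : t ≤ 40 * L * (L * l) := by nlinarith
        gcongr
    _ = 13000 * L ^ 2 * l := by ring

theorem logb_div_le_of_rpow_neg_le {n : ℕ} {ε a : ℝ} (hn : 2 ≤ n) (hε : 0 < ε)
    (h : (n : ℝ) ^ (-a) ≤ ε) : Real.logb 2 (n / ε) ≤ (1 + a) * Real.logb 2 n := by
  have hn0 : (0 : ℝ) < n := by exact_mod_cast (by omega : 0 < n)
  have h1 := Real.logb_le_logb_of_le (b := 2) (by norm_num) (Real.rpow_pos_of_pos hn0 _) h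
  rw [Real.logb_rpow_eq_mul_logb_of_pos hn0] at h1
  rw [Real.logb_div hn0.ne' hε.ne']
  linarith

theorem exists_composed_extractor {n m : ℕ} {ε : ℝ} (hm : 2 ≤ m) (hmn : m ≤ n) (hε : 0 < ε)
    (hε1 : ε < 1) :
    ∃ (m₁ m₂ d₁ d₂ : ℕ) (E₁ : BitString n → BitString d₁ → BitString m₁)
      (E₂ : BitString n → BitString d₂ → BitString m₂),
      m₁ + m₂ = m ∧ IsTrevisanExtractor (ε / 2) E₁ ∧
      IsAlmostTwoUniversal ((1 + (ε / 2) ^ 2) / 2 ^ m₂) E₂ ∧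
      IsQuantumProofStrongExtractor (m + 4 * Real.logb 2 (1 / ε) + 7) ε (compose E₁ E₂) ∧
      ((d₁ + d₂ : ℕ) : ℝ) ≤ 13000 * Real.logb 2 (n / ε) ^ 2 * Real.logb 2 m := by
  have hm0 : (2 : ℝ) ≤ m := by exact_mod_cast hm
  have hmn0 : (m : ℝ) ≤ n := by exact_mod_cast hmn
  have hn0 : (0 : ℝ) < n := by linarith
  -- About `2 log m` bits are left to hashing, so that `2 ^ m₂` compensates the factor `M ^ 2` lost
  -- in the hybrid argument (`hM2`). For small `m` everything is hashed and `m₁ = 0`.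
  set m₂ := min m (2 * Nat.clog 2 m) with hm₂
  set m₁ := m - m₂ with hm₁
  have hmm : m₁ + m₂ = m := Nat.sub_add_cancel (min_le_left _ _)
  set M : ℕ := max m₁ 1 with hM
  have hM1 : (1 : ℝ) ≤ M := by exact_mod_cast le_max_right m₁ 1
  have hMm : (M : ℝ) ≤ m := by
    exact_mod_cast max_le (Nat.sub_le m m₂) (by omega : 1 ≤ m)
  have hm₁M : (m₁ : ℝ) ≤ M := by exact_mod_cast le_max_left m₁ 1
  have hM2 : (M : ℝ) ^ 2 ≤ 2 ^ m₂ := by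
    rcases le_total m (2 * Nat.clog 2 m) with h | h
    · have : M = 1 := by
        rw [hM, hm₁, hm₂, min_eq_left h, Nat.sub_self]; rfl
      rw [this, Nat.cast_one, one_pow]
      exact one_le_pow₀ (by norm_num)
    · have h1 : (m : ℝ) ≤ 2 ^ Nat.clog 2 m := by
        exact_mod_cast Nat.le_pow_clog (by norm_num) m
      rw [hm₂, min_eq_right h, mul_comm 2, pow_mul]
      exact pow_le_pow_left₀ (by linarith) (hMm.trans h1) 2
  have hm₂4 : (2 : ℝ) ^ m₂ ≤ 4 * m ^ 2 := by
    have h1 : 2 ^ (Nat.clog 2 m).pred < m := Nat.pow_pred_clog_lt_self (by norm_num) (by omega)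
    have hc : 0 < Nat.clog 2 m := Nat.clog_pos (by norm_num) hm
    have h2 : (2 : ℝ) ^ Nat.clog 2 m ≤ 2 * m := by
      have e : 2 ^ Nat.clog 2 m = 2 * 2 ^ (Nat.clog 2 m).pred := by
        rw [← pow_succ', Nat.pred_eq_sub_one, Nat.sub_add_cancel hc]
      exact_mod_cast (by omega : 2 ^ Nat.clog 2 m ≤ 2 * m)
    calc (2 : ℝ) ^ m₂ ≤ 2 ^ (Nat.clog 2 m * 2) :=
          pow_le_pow_right₀ (by norm_num) (by rw [mul_comm]; exact min_le_right _ _)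
      _ = ((2 : ℝ) ^ Nat.clog 2 m) ^ 2 := pow_mul _ _ _
      _ ≤ (2 * m) ^ 2 := by gcongr
      _ = 4 * m ^ 2 := by ring
  -- Large enough that `γ` lies below the Johnson threshold `δ ^ 2 / 2 = ε ^ 4 / (2592 M ^ 4)` for
  -- error `ε / 2`, and that `η ≤ ε ^ 2 / 8`.
  obtain ⟨s, hs⟩ : ∃ s, s = ⌈Real.logb 2 (10000 * n * m ^ 4 / ε ^ 4)⌉₊ := ⟨_, rfl⟩
  have hs2 : 10000 * n * m ^ 4 / ε ^ 4 ≤ (2 : ℝ) ^ s := by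
    rw [← Real.rpow_natCast 2 s, ← Real.logb_le_iff_le_rpow (by norm_num) (by positivity), hs]
    exact Nat.le_ceil _
  have hs3 : 10000 * n * m ^ 4 ≤ ε ^ 4 * (2 : ℝ) ^ s := by
    rw [div_le_iff₀ (by positivity)] at hs2; linarith
  have hε2 : ε ^ 2 ≤ 1 := pow_le_one₀ hε.le hε1.le
  have hε4 : ε ^ 4 ≤ ε ^ 2 := pow_le_pow_of_le_one hε.le hε1.le (by norm_num)
  have hm4 : 4 * (m : ℝ) ^ 2 < 2 ^ s := by
    have h1 : (2 : ℝ) * m ^ 2 ≤ n * m ^ 4 := by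
      calc (2 : ℝ) * m ^ 2 ≤ n * (m : ℝ) ^ 2 := by gcongr; linarith
        _ ≤ n * (m : ℝ) ^ 4 := by gcongr <;> linarith
    have h2 : ε ^ 4 * (2 : ℝ) ^ s ≤ 1 * 2 ^ s := by gcongr; linarith
    nlinarith
  have hm₂s : m₂ ≤ s := by
    have : (2 : ℝ) ^ m₂ < 2 ^ s := by linarith
    exact ((pow_lt_pow_iff_right₀ (by norm_num)).mp this).le
  have hs0 : s ≠ 0 := by
    rintro h0
    rw [h0, pow_zero] at hm4
    nlinarith
  have hs1 : 1 ≤ s := Nat.one_le_iff_ne_zero.mpr hs0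
  have hPpos : (0 : ℝ) < 2 ^ s := by positivity
  set γ : ℝ := n * 2 / 2 ^ s with hγ
  have hγ0 : 0 ≤ γ := by positivity
  have hγm : γ ≤ ε ^ 4 / (5000 * m ^ 4) := by
    rw [hγ, div_le_div_iff₀ hPpos (by positivity)]; linarith
  obtain ⟨F, hF⟩ := exists_almost_universal n (m := 1) hs0 hs1 (η := γ)
    (by rw [hγ, div_mul_cancel₀ _ hPpos.ne', pow_one])
  let code : BitString n → BitString (s + s) → Bool := fun x y => F x y 0
  have hcode : ∀ x x', x ≠ x' → ((Finset.univ.filter fun y => code x y = code x' y).card : ℝ) ≤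
      (1 + γ) / 2 * 2 ^ (s + s) := by
    intro x x' hx
    have h := hF x x' hx
    rw [pow_one] at h
    have e : ∀ y, F x y = F x' y ↔ code x y = code x' y := by
      intro y
      exact ⟨fun h => congrFun h 0, fun h => funext fun i => by rw [Subsingleton.elim i 0]; exact h⟩
    simpa only [e] using h
  set η : ℝ := n * 2 ^ m₂ / 2 ^ s with hη
  have hη0 : 0 ≤ η := by positivity
  have hη8 : η ≤ ε ^ 2 / 8 := by
    rw [hη, div_le_div_iff₀ hPpos (by norm_num)]
    have h1 : (m : ℝ) ^ 2 ≤ m ^ 4 := by gcongr <;> linarith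
    calc n * 2 ^ m₂ * 8 ≤ n * (4 * (m : ℝ) ^ 4) * 8 := by gcongr; linarith
      _ ≤ 10000 * n * (m : ℝ) ^ 4 := by
          have : 0 ≤ (n : ℝ) * m ^ 4 := by positivity
          linarith
      _ ≤ ε ^ 4 * 2 ^ s := hs3
      _ ≤ ε ^ 2 * 2 ^ s := by gcongr
  obtain ⟨E₂, hE₂⟩ := exists_almost_universal n hs0 hm₂s (η := η)
    (by rw [hη, div_mul_cancel₀ _ hPpos.ne'])
  obtain ⟨S, hS⟩ := exists_weakDesign (s + s) m₁
  set k : ℝ := m + 4 * Real.logb 2 (1 / ε) + 6 with hk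
  have hlog0 : 0 ≤ Real.logb 2 (1 / ε) :=
    Real.logb_nonneg (by norm_num) (by rw [le_div_iff₀ hε]; linarith)
  have hk0 : 0 ≤ k := by rw [hk]; linarith
  have h2k : (2 : ℝ) ^ (-k) * (2 ^ m₁ * 2 ^ m₂) = ε ^ 4 / 64 := by
    have e : -k = -(m : ℝ) + (Real.logb 2 ε * (4 : ℕ) + (-(6 : ℕ) : ℝ)) := by
      rw [hk, one_div, Real.logb_inv]; push_cast; ring
    rw [e, Real.rpow_add (by norm_num), Real.rpow_add (by norm_num), Real.rpow_mul (by norm_num),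
      Real.rpow_logb (by norm_num) (by norm_num) hε, ← pow_add, hmm, Real.rpow_neg (by norm_num),
      Real.rpow_neg (by norm_num), Real.rpow_natCast, Real.rpow_natCast, Real.rpow_natCast]
    field_simp
    norm_num
  have hcol : (0 : ℝ) < 2 ^ (-k) * 2 ^ m₁ := by positivity
  have hMpos : (0 : ℝ) < M := by linarith
  -- Each of the `m₁` bits gets error `ε / (2 M)` and the hashing stage `ε / 2`. The `6` in `k`
  -- makes the entropy terms fit beside `γ` and `η`; one further bit gives the final `7`.
  have hsec := isQuantumProofStrongExtractor_compose code S hS E₂ (k := k) (θ₁ := ε / (2 * M))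
    (θ₂ := ε / 2) hγ0 hη0 (by positivity) (by positivity) hk0 hcode hE₂ ?_ ?_
  · refine ⟨m₁, m₂, _, s + s, trevisan code S hS.card_eq, E₂, hmm,
      ⟨s + s, (ε / 2) ^ 2 / (9 * (M : ℝ) ^ 2), code, S, hS, rfl, ?_, rfl, rfl⟩, ?_, ?_, ?_⟩
    · refine isListDecodable_of_agreement_le code (γ := γ) (by positivity) ?_ ?_
      · refine hγm.trans ?_
        have h1 : (M : ℝ) ^ 4 ≤ m ^ 4 := by gcongr
        have e : ((ε / 2) ^ 2 / (9 * (M : ℝ) ^ 2)) ^ 2 / 2 = ε ^ 4 / (2592 * M ^ 4) := by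
          field_simp; norm_num
        rw [e]
        gcongr
        norm_num
      · simpa using hcode
    · intro x x' hx
      rw [div_le_iff₀ (by positivity)]
      refine (hE₂ x x' hx).trans ?_
      gcongr
      nlinarith [sq_nonneg ε]
    · refine hsec.mono (by rw [hk]; linarith) ?_
      have : m₁ * (ε / (2 * M)) ≤ ε / 2 := by
        calc m₁ * (ε / (2 * M)) ≤ M * (ε / (2 * M)) := by gcongr
          _ = ε / 2 := by field_simp
      linarith
    · exact seed_length_le hm hmn (Nat.sub_le _ _) hε hε1 hs
  · have e : (ε / (2 * M)) ^ 2 = ε ^ 2 / 8 / M ^ 2 + ε ^ 2 / 8 / M ^ 2 := by field_simp; norm_num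
    rw [e]
    refine add_le_add ?_ ?_
    · refine hγm.trans ?_
      rw [div_div]
      have h1 : (M : ℝ) ^ 2 ≤ m ^ 4 := by
        calc (M : ℝ) ^ 2 ≤ (m : ℝ) ^ 2 := by gcongr
          _ ≤ (m : ℝ) ^ 4 := by gcongr <;> linarith
      gcongr
      norm_num
    · rw [le_div_iff₀ (by positivity)]
      calc 2 * (2 : ℝ) ^ (-k) * 2 * 2 ^ m₁ * M ^ 2 ≤ 2 * (2 : ℝ) ^ (-k) * 2 * 2 ^ m₁ * 2 ^ m₂ := by
            gcongr
        _ = 4 * ((2 : ℝ) ^ (-k) * (2 ^ m₁ * 2 ^ m₂)) := by ring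
        _ ≤ ε ^ 2 / 8 := by rw [h2k]; nlinarith [sq_nonneg ε]
  · calc η + 2 * (2 : ℝ) ^ (-k) * 2 ^ m₂ * 2 ^ m₁
        = η + 2 * ((2 : ℝ) ^ (-k) * (2 ^ m₁ * 2 ^ m₂)) := by ring
      _ ≤ (ε / 2) ^ 2 := by rw [h2k]; nlinarith [sq_nonneg ε]

end QExtractor

theorem mainTheorem3 :
    ∃ (c C : ℝ) (C' : ℝ → ℝ), ∀ (n m : ℕ) (ε : ℝ), 2 ≤ m → m ≤ n → 0 < ε → ε < 1 →
      ∃ (m₁ m₂ d₁ d₂ : ℕ) (ε₁ ε₂ : ℝ)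
        (E₁ : QExtractor.BitString n → QExtractor.BitString d₁ → QExtractor.BitString m₁)
        (E₂ : QExtractor.BitString n → QExtractor.BitString d₂ → QExtractor.BitString m₂),
        m₁ + m₂ = m ∧ 0 < ε₁ ∧ 0 < ε₂ ∧ ε₁ + ε₂ = ε ∧
        QExtractor.IsTrevisanExtractor ε₁ E₁ ∧
        QExtractor.IsAlmostTwoUniversal ((1 + ε₂ ^ 2) / 2 ^ m₂) E₂ ∧
        QExtractor.IsQuantumProofStrongExtractor
          (m + 4 * Real.logb 2 (1 / ε) + c) ε (QExtractor.compose E₁ E₂) ∧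
        ((d₁ + d₂ : ℕ) : ℝ) ≤ C * Real.logb 2 (n / ε) ^ 2 * Real.logb 2 m ∧
        ∀ a : ℝ, 0 ≤ a → (n : ℝ) ^ (-a) ≤ ε →
          ((d₁ + d₂ : ℕ) : ℝ) ≤ C' a * Real.logb 2 n ^ 3 := by
  -- For `ε ≥ n ^ (-a)` one has `log (n / ε) ≤ (1 + a) log n`, and this factor enters squared.
  refine ⟨7, 13000, fun a => 13000 * (1 + a) ^ 2, fun n m ε hm hmn hε hε1 => ?_⟩
  obtain ⟨m₁, m₂, d₁, d₂, E₁, E₂, h1, h2, h3, h4, h5⟩ :=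
    QExtractor.exists_composed_extractor hm hmn hε hε1
  refine ⟨m₁, m₂, d₁, d₂, ε / 2, ε / 2, E₁, E₂, h1, half_pos hε, half_pos hε, add_halves ε, h2, h3,
    h4, h5, fun a _ han => h5.trans ?_⟩
  have hm0 : (2 : ℝ) ≤ m := by exact_mod_cast hm
  have hmn0 : (m : ℝ) ≤ n := by exact_mod_cast hmn
  have hL := QExtractor.logb_div_le_of_rpow_neg_le (hm.trans hmn) hε han
  have hL0 : 0 ≤ Real.logb 2 (n / ε) := by
    refine Real.logb_nonneg (by norm_num) ?_
    rw [le_div_iff₀ hε]; linarith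
  have hl : Real.logb 2 m ≤ Real.logb 2 n :=
    Real.logb_le_logb_of_le (by norm_num) (by linarith) hmn0
  have hl0 : 0 ≤ Real.logb 2 m := Real.logb_nonneg (by norm_num) (by linarith)
  calc 13000 * Real.logb 2 (n / ε) ^ 2 * Real.logb 2 m
      ≤ 13000 * ((1 + a) * Real.logb 2 n) ^ 2 * Real.logb 2 n := by gcongr
    _ = 13000 * (1 + a) ^ 2 * Real.logb 2 n ^ 3 := by ring
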